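/- **Data model.** Fix a countably infinite set $\mathbf{dom}$ of atomic values. *Values* and *paths* are defined by mutual induction: every atomic value is a value, every finite sequence of values is a path (the empty path is allowed), and for every path $p$ the packed value $\langle p\rangle$ is a value; a value is identified with the path of length one. A *schema* is a finite set of relation names with arities (infinitely many names of each arity are available); an *instance* of a schema $\Gamma$ assigns to each $n$-ary $R\in\Gamma$ a finite set of $n$-tuples of paths. *Path expressions* are built from atomic values, atomic variables (ranging over $\mathbf{dom}$) and path variables (ranging over paths) by packing $\langle\cdot\rangle$ and finite (possibly empty) concatenation. **Sequence Datalog.** An *atom* is a predicate $R(e_1,\dots,e_n)$ or an equation $e_1=e_2$ between path expressions. A *rule* consists of a head predicate and a finite body of atoms and negated atoms. It must be *safe*: all its variables are limited, where the variables of positive body predicates are limited, and if all variables of one side of a positive body equation are limited then so are those of the other side. A *program* is a finite sequence of strata, which are finite sets of safe rules, such that a relation name occurring in a negated predicate in some stratum is not the head of a rule in that or a later stratum. The *IDB* names are those occurring in heads, the *EDB* names the other names that occur; the program is *over* $\Gamma$ if its EDB names belong to $\Gamma$ and its IDB names do not. It is *nonrecursive* if the graph on the IDB names, with an edge from $R_1$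 to $R_2$ whenever $R_2$ occurs (possibly negated) in the body of a rule with head $R_1$, has no cycle. For an instance $I$ of $\Gamma$, $P(I)$ is obtained by applying the strata in order; applying a stratum to an instance yields the smallest (finite) instance that contains it, agrees with it on all names that are not heads of the stratum, and satisfies all rules of the stratum. **Sequence relational algebra.** Expressions over $\Gamma$ are built from the relation names in $\Gamma$ and finite constant relations by union, difference, cartesian product and the following operators on $n$-ary relations $R$, where $\alpha,\beta,\alpha_1,\dots,\alpha_p$ are path expressions over the path variables $\$1,\dots,\$n$, $t(\alpha)$ results from $\alpha$ by substituting $t_i$ for each $\$i$, and $i\in\{1,\dots,n\}$: $$\sigma_{\alpha=\beta}(R)=\{t\in R\mid t(\alpha)=t(\beta)\},\qquad \pi_{\alpha_1,\dots,\alpha_p}(R)=\{(t(\alpha_1),\dots,t(\alpha_p))\mid t\in R\},$$ $$\mathit{UNPACK}_i(R)=\{(t_1,\dots,t_{i-1},s,t_{i+1},\dots,t_n)\mid (t_1,\dots,t_{i-1},\langle s\rangle,t_{i+1},\dots,t_n)\in R\},$$ $$\mathit{SUB}_i(R)=\{(t_1,\dots,t_n,s)\mid (t_1,\dots,t_n)\in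 R,\ s \text{ is a (contiguous, possibly empty) substring of } t_i\}.$$ **Theorem.** Let $\Gamma$ be a schema. 1. For every nonrecursive Sequence Datalog program $P$ over $\Gamma$ and every IDB relation name $T$ of $P$, there is a sequence relational algebra expression $E$ over $\Gamma$ such that, for every instance $I$ of $\Gamma$, $P(I)$ is defined and $P(I)(T)=E(I)$. 2. Conversely, for every sequence relational algebra expression $E$ over $\Gamma$ there are a nonrecursive Sequence Datalog program $P$ over $\Gamma$ and an IDB relation name $T$ of $P$, of the same arity as $E$, such that, for every instance $I$ of $\Gamma$, $P(I)$ is defined and $P(I)(T)=E(I)$. -/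

import Mathlib

namespace SeqDatalog

universe u

/-! ### Data model -/

/-- Values over the universe `D` of atomic values: atomic values and packed values `⟨p⟩`, where `p`
is a path, that is, a finite sequence of values. -/
inductive Value (D : Type u) : Type u
  | atom : D → Value D
  | pack : List (Value D) → Value D

/-- Paths: finite sequences of values. A value is identified with the corresponding path of
length one. -/
abbrev Path (D : Type u) : Type u := List (Value D)

/-- Relation names with their arities; each arity has an infinite supply of names. -/
structure RelName where
  id : ℕ
  arity : ℕ

/-- A schema is a finite set of relation names. -/
abbrev Schema : Type := Finset RelName

/-- `n`-tuples of paths. -/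
abbrev Tuple (D : Type u) (n : ℕ) : Type u := Fin n → Path D

/-- An assignment of finite relations on paths to relation names. The instances of a schema `Γ`
are those with `I.Over Γ`: relation names outside `Γ` carry no facts. -/
@[ext]
structure Instance (D : Type u) where
  rel : (R : RelName) → Set (Tuple D R.arity)
  finite : ∀ R, (rel R).Finite

/-- `I` is an instance of the schema `Γ`. -/
def Instance.Over {D : Type u} (I : Instance D) (Γ : Schema) : Prop :=
  ∀ R, R ∉ Γ → I.rel R = ∅

/-- Instances are ordered by inclusion of their sets of facts. -/
instance {D : Type u} : PartialOrder (Instance D) where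
  le I J := ∀ R, I.rel R ⊆ J.rel R
  le_refl _ _ := subset_rfl
  le_trans _ _ _ h k R := (h R).trans (k R)
  le_antisymm _ _ h k := Instance.ext (funext fun R => (h R).antisymm (k R))

/-! ### Path expressions -/

/-- Path expressions with atomic variables from `A` and path variables from `X`. Finite sequences
are built from the empty sequence and concatenation. -/
inductive PathExpr (D : Type u) (A X : Type) : Type u
  | const : D → PathExpr D A X
  | avar : A → PathExpr D A X
  | pvar : X → PathExpr D A X
  | pack : PathExpr D A X → PathExpr D A X
  | empty : PathExpr D A X
  | concat : PathExpr D A X → PathExpr D A X → PathExpr D A X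

namespace PathExpr

variable {D : Type u} {A X : Type}

/-- The path `ν(e)`, for the valuation `ν` that is `f` on atomic variables and `g` on path
variables. -/
def eval (f : A → D) (g : X → Path D) : PathExpr D A X → Path D
  | const a => [Value.atom a]
  | avar x => [Value.atom (f x)]
  | pvar x => g x
  | pack e => [Value.pack (e.eval f g)]
  | empty => []
  | concat e₁ e₂ => e₁.eval f g ++ e₂.eval f g

/-- The variables occurring in a path expression; `Sum.inl` marks atomic variables and `Sum.inr`
path variables. -/
def vars : PathExpr D A X → Set (A ⊕ X)
  | const _ => ∅
  | avar x => {Sum.inl x}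
  | pvar x => {Sum.inr x}
  | pack e => e.vars
  | empty => ∅
  | concat e₁ e₂ => e₁.vars ∪ e₂.vars

end PathExpr

/-! ### Syntax of Sequence Datalog -/

/-- Variables of Sequence Datalog: `Sum.inl` for atomic and `Sum.inr` for path variables. -/
abbrev Var : Type := ℕ ⊕ ℕ

/-- Path expressions of Sequence Datalog. -/
abbrev Expr (D : Type u) : Type u := PathExpr D ℕ ℕ

/-- Predicates `R(e₁, …, eₙ)`. -/
structure Predicate (D : Type u) where
  name : RelName
  args : Fin name.arity → Expr D

/-- Atoms: predicates and equations. -/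
inductive Atom (D : Type u) : Type u
  | pred : Predicate D → Atom D
  | eqn : Expr D → Expr D → Atom D

/-- Literals: atoms and negated atoms. -/
inductive Literal (D : Type u) : Type u
  | pos : Atom D → Literal D
  | neg : Atom D → Literal D

/-- Rules `head ← body`. Only membership in the list `body` matters. -/
structure Rule (D : Type u) where
  head : Predicate D
  body : List (Literal D)

variable {D : Type u}

def Predicate.vars (p : Predicate D) : Set Var := ⋃ i, (p.args i).vars

def Atom.vars : Atom D → Set Var
  | pred p => p.vars
  | eqn e₁ e₂ => e₁.vars ∪ e₂.vars

def Literal.atom : Literal D → Atom D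
  | pos a => a
  | neg a => a

def Rule.vars (r : Rule D) : Set Var := r.head.vars ∪ {v | ∃ L ∈ r.body, v ∈ L.atom.vars}

/-- The limited variables of a rule. -/
inductive Rule.Limited (r : Rule D) : Var → Prop
  | ofPred (p : Predicate D) (v : Var) :
      Literal.pos (Atom.pred p) ∈ r.body → v ∈ p.vars → Rule.Limited r v
  | ofLeft (e₁ e₂ : Expr D) (v : Var) :
      Literal.pos (Atom.eqn e₁ e₂) ∈ r.body → (∀ w ∈ e₁.vars, Rule.Limited r w) →
        v ∈ e₂.vars → Rule.Limited r v
  | ofRight (e₁ e₂ : Expr D) (v : Var) :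
      Literal.pos (Atom.eqn e₁ e₂) ∈ r.body → (∀ w ∈ e₂.vars, Rule.Limited r w) →
        v ∈ e₁.vars → Rule.Limited r v

/-- A rule is safe if all its variables are limited. -/
def Rule.Safe (r : Rule D) : Prop := ∀ v ∈ r.vars, r.Limited v

/-- A relation name occurs, positively or negated, in the body of a rule. -/
def Rule.Uses (r : Rule D) (R : RelName) : Prop :=
  ∃ L ∈ r.body, ∃ p : Predicate D, L.atom = Atom.pred p ∧ p.name = R

/-- A stratum is a finite set of rules, given as a list. -/
abbrev Stratum (D : Type u) : Type u := List (Rule D)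

/-- The relation names used in heads of rules of a stratum. -/
def Stratum.heads (S : Stratum D) : Set RelName := {R | ∃ r ∈ S, r.head.name = R}

/-- Stratified negation: if a negated predicate on `R` occurs in a stratum, then no rule in that
stratum or in a later one has `R` in its head. -/
def Stratified : List (Stratum D) → Prop
  | [] => True
  | S :: rest =>
      (∀ r ∈ S, ∀ p : Predicate D, Literal.neg (Atom.pred p) ∈ r.body →
        ∀ S' ∈ S :: rest, p.name ∉ Stratum.heads S') ∧ Stratified rest

/-- Sequence Datalog programs. -/
structure Program (D : Type u) where
  strata : List (Stratum D)
  safe : ∀ S ∈ strata, ∀ r ∈ S, r.Safe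
  stratified : Stratified strata

/-- `r` is one of the rules of `P`. -/
def Program.HasRule (P : Program D) (r : Rule D) : Prop := ∃ S ∈ P.strata, r ∈ S

/-- IDB relation names: those used in the head of some rule. -/
def Program.idb (P : Program D) : Set RelName := {R | ∃ r, P.HasRule r ∧ r.head.name = R}

/-- EDB relation names: the other relation names occurring in the program. -/
def Program.edb (P : Program D) : Set RelName := {R | (∃ r, P.HasRule r ∧ r.Uses R) ∧ R ∉ P.idb}

/-- `P` is a program over the schema `Γ`. -/
def Program.Over (P : Program D) (Γ : Schema) : Prop :=
  (∀ R ∈ P.edb, R ∈ Γ) ∧ ∀ R ∈ P.idb, R ∉ Γ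

/-- Edges of the dependency graph, whose nodes are the IDB relation names. -/
def Program.DependsOn (P : Program D) (R₁ R₂ : RelName) : Prop :=
  R₁ ∈ P.idb ∧ R₂ ∈ P.idb ∧ ∃ r, P.HasRule r ∧ r.head.name = R₁ ∧ r.Uses R₂

/-- A program is nonrecursive if its dependency graph has no cycle (loops are cycles). -/
def Program.Nonrecursive (P : Program D) : Prop :=
  ∀ R, ¬ Relation.TransGen P.DependsOn R R

/-! ### Semantics of Sequence Datalog -/

/-- Valuations. -/
structure Valuation (D : Type u) where
  onAtomic : ℕ → D
  onPath : ℕ → Path D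

/-- The path `ν(e)`. -/
def Valuation.apply (ν : Valuation D) (e : Expr D) : Path D := e.eval ν.onAtomic ν.onPath

/-- `I, ν` satisfies the predicate `p`: the fact `ν(p)` is in `I`. -/
def Predicate.Sat (I : Instance D) (ν : Valuation D) (p : Predicate D) : Prop :=
  (fun i => ν.apply (p.args i)) ∈ I.rel p.name

def Atom.Sat (I : Instance D) (ν : Valuation D) : Atom D → Prop
  | pred p => p.Sat I ν
  | eqn e₁ e₂ => ν.apply e₁ = ν.apply e₂

def Literal.Sat (I : Instance D) (ν : Valuation D) : Literal D → Prop
  | pos a => a.Sat I ν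
  | neg a => ¬ a.Sat I ν

/-- The rule `r` is satisfied in `I`. -/
def Rule.SatisfiedIn (r : Rule D) (I : Instance D) : Prop :=
  ∀ ν : Valuation D, (∀ L ∈ r.body, L.Sat I ν) → r.head.Sat I ν

/-- `J` is the result of applying the stratum `S` to `I`: the smallest instance that contains `I`,
agrees with `I` on all relation names that are not heads of `S`, and satisfies the rules of `S`.
(If `I` has no facts on the heads of `S`, then the inclusion of `I` follows from the agreement.) -/
def Stratum.IsResult (S : Stratum D) (I J : Instance D) : Prop :=
  IsLeast {K : Instance D | I ≤ K ∧ (∀ R, R ∉ S.heads → K.rel R = I.rel R) ∧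
    ∀ r ∈ S, r.SatisfiedIn K} J

/-- `J` results from `I` by applying the strata one after the other. -/
def StrataResult : List (Stratum D) → Instance D → Instance D → Prop
  | [], I, J => J = I
  | S :: rest, I, J => ∃ K, Stratum.IsResult S I K ∧ StrataResult rest K J

/-- `P(I)` is defined and equal to `J`. -/
def Program.IsResult (P : Program D) (I J : Instance D) : Prop := StrataResult P.strata I J

theorem StrataResult.unique : ∀ {Q : List (Stratum D)} {I J J' : Instance D},
    StrataResult Q I J → StrataResult Q I J' → J = J'
  | [], _, _, _, h, h' => h.trans h'.symm
  | _ :: _, _, _, _, ⟨_, hK, h⟩, ⟨_, hK', h'⟩ => by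
    cases IsLeast.unique hK hK'
    exact StrataResult.unique h h'

/-- The result `P(I)` is unique. -/
theorem Program.IsResult.unique {P : Program D} {I J J' : Instance D}
    (h : P.IsResult I J) (h' : P.IsResult I J') : J = J' :=
  StrataResult.unique h h'

/-! ### Sequence relational algebra -/

/-- Path expressions over the path variables `$1, …, $n`. -/
abbrev ColExpr (D : Type u) (n : ℕ) : Type u := PathExpr D Empty (Fin n)

/-- The path `t(α)`, where `t` is viewed as the valuation that maps `$i` to `tᵢ`. -/
def ColExpr.apply {n : ℕ} (t : Tuple D n) (α : ColExpr D n) : Path D :=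
  PathExpr.eval (fun x => x.elim) t α

/-- Sequence relational algebra expressions over `Γ`, indexed by the arity of their result. -/
inductive AlgExpr (D : Type u) (Γ : Schema) : ℕ → Type u
  | rel (R : RelName) : R ∈ Γ → AlgExpr D Γ R.arity
  | const {n : ℕ} : Finset (Tuple D n) → AlgExpr D Γ n
  | union {n : ℕ} : AlgExpr D Γ n → AlgExpr D Γ n → AlgExpr D Γ n
  | diff {n : ℕ} : AlgExpr D Γ n → AlgExpr D Γ n → AlgExpr D Γ n
  | prod {m n : ℕ} : AlgExpr D Γ m → AlgExpr D Γ n → AlgExpr D Γ (m + n)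
  | select {n : ℕ} : ColExpr D n → ColExpr D n → AlgExpr D Γ n → AlgExpr D Γ n
  | project {n p : ℕ} : (Fin p → ColExpr D n) → AlgExpr D Γ n → AlgExpr D Γ p
  | unpack {n : ℕ} : Fin n → AlgExpr D Γ n → AlgExpr D Γ n
  | sub {n : ℕ} : Fin n → AlgExpr D Γ n → AlgExpr D Γ (n + 1)

/-- The relation `E(I)`. Substrings are contiguous: `s <:+: p` says `p = u ++ s ++ v` for some
`u`, `v`. -/
def AlgExpr.eval {Γ : Schema} (I : Instance D) : {n : ℕ} → AlgExpr D Γ n → Set (Tuple D n)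
  | _, .rel R _ => I.rel R
  | _, .const C => {t | t ∈ C}
  | _, .union E F => E.eval I ∪ F.eval I
  | _, .diff E F => E.eval I \ F.eval I
  | _, .prod E F => {u | ∃ s ∈ E.eval I, ∃ t ∈ F.eval I, u = Fin.append s t}
  | _, .select α β E => {t | t ∈ E.eval I ∧ α.apply t = β.apply t}
  | _, .project α E => {u | ∃ t ∈ E.eval I, u = fun j => (α j).apply t}
  | _, .unpack i E =>
      {u | ∃ t ∈ E.eval I, ∃ s : Path D, t i = [Value.pack s] ∧ u = Function.update t i s}
  | _, .sub i E =>
      {u | ∃ t ∈ E.eval I, ∃ s : Path D, s <:+: t i ∧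
        u = Fin.snoc (α := fun _ => Path D) t s}

end SeqDatalog

/-!
From Datalog to algebra, an instance is carried along symbolically, as a family of algebra
expressions, one for each relation name. If the relations in the body of a safe rule are given by
algebra expressions, then so is the set of facts the rule derives: by induction on limitedness,
every variable takes its values in a definable relation, since a variable of a path expression
denotes a path reached from the value of the expression by `SUB` and `UNPACK`. All valuations that
matter are therefore tuples of a definable relation, from which the body selects by semijoins,
antijoins and selections. In a nonrecursive stratum, recursion along the dependency order turns
this into expressions for the least fixed point.

From algebra to Datalog, a program grows by one stratum for each operator. The new stratum defines
one fresh relation name, whose identifier exceeds all earlier ones, so that identifiers decrease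
along the dependency graph. `SUB` is the rule `T(x̄, s) ← R(x̄), xᵢ = y·s·z`, which is safe because
the equation limits `y`, `s` and `z`.
-/

namespace SeqDatalog

universe u

variable {D : Type u} {Γ : Schema}

/-! ### Substitution in path expressions -/

namespace PathExpr

variable {A B X Y : Type}

/-- The valuation given by `f` and `g`, as a single function on all variables. -/
def varVal (f : A → D) (g : X → Path D) : A ⊕ X → Path D :=
  Sum.elim (fun a => [Value.atom (f a)]) g

/-- Simultaneous substitution of path expressions for variables. -/
def subst (s : A ⊕ X → PathExpr D B Y) : PathExpr D A X → PathExpr D B Y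
  | const a => const a
  | avar x => s (Sum.inl x)
  | pvar x => s (Sum.inr x)
  | pack e => pack (e.subst s)
  | empty => empty
  | concat e₁ e₂ => concat (e₁.subst s) (e₂.subst s)

theorem eval_subst {f : A → D} {g : X → Path D} {f' : B → D} {g' : Y → Path D}
    {s : A ⊕ X → PathExpr D B Y} {e : PathExpr D A X}
    (h : ∀ v ∈ e.vars, (s v).eval f' g' = varVal f g v) :
    (e.subst s).eval f' g' = e.eval f g := by
  induction e with
  | const a => rfl
  | avar x => exact h (Sum.inl x) rfl
  | pvar x => exact h (Sum.inr x) rfl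
  | pack e ih => simp only [subst, eval, ih h]
  | empty => rfl
  | concat e₁ e₂ ih₁ ih₂ =>
    simp only [subst, eval, ih₁ fun v hv => h v (Or.inl hv), ih₂ fun v hv => h v (Or.inr hv)]

theorem vars_subst (s : A ⊕ X → PathExpr D B Y) (e : PathExpr D A X) :
    (e.subst s).vars = ⋃ v ∈ e.vars, (s v).vars := by
  induction e with
  | const a => simp [subst, vars]
  | avar x => simp [subst, vars]
  | pvar x => simp [subst, vars]
  | pack _ ih => exact ih
  | empty => simp [subst, vars]
  | concat e₁ e₂ ih₁ ih₂ => simp only [subst, vars, ih₁, ih₂, Set.biUnion_union]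

theorem finite_vars (e : PathExpr D A X) : e.vars.Finite := by
  induction e with
  | const _ => exact Set.finite_empty
  | avar x => exact Set.finite_singleton _
  | pvar x => exact Set.finite_singleton _
  | pack _ ih => exact ih
  | empty => exact Set.finite_empty
  | concat e₁ e₂ ih₁ ih₂ => exact ih₁.union ih₂

mutual

/-- The expression without variables that denotes the path of length one given by a value. -/
def ofValue : Value D → PathExpr D A X
  | .atom a => .const a
  | .pack p => .pack (ofPath p)

/-- The expression without variables that denotes a given path. -/
def ofPath : List (Value D) → PathExpr D A X
  | [] => .empty
  | x :: p => .concat (ofValue x) (ofPath p)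

end

mutual

theorem eval_ofValue (f : A → D) (g : X → Path D) : (x : Value D) → (ofValue x).eval f g = [x]
  | .atom _ => rfl
  | .pack p => by rw [ofValue, eval, eval_ofPath f g p]

theorem eval_ofPath (f : A → D) (g : X → Path D) :
    (p : List (Value D)) → (ofPath p).eval f g = p
  | [] => rfl
  | x :: p => by rw [ofPath, eval, eval_ofValue f g x, eval_ofPath f g p, List.singleton_append]

end

end PathExpr

/-- The path that a valuation assigns to a variable. -/
def Valuation.val (ν : Valuation D) : Var → Path D := PathExpr.varVal ν.onAtomic ν.onPath

theorem Valuation.exists_forall_val_eq [Nonempty D] {V : Set Var} {w : Var → Path D}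
    (h : ∀ v ∈ V, ∃ ν : Valuation D, ν.val v = w v) :
    ∃ ν : Valuation D, ∀ v ∈ V, ν.val v = w v := by
  have hatom (i : ℕ) : ∃ a : D, Sum.inl i ∈ V → [Value.atom a] = w (Sum.inl i) := by
    by_cases hi : Sum.inl i ∈ V
    · obtain ⟨ν, hν⟩ := h _ hi
      exact ⟨ν.onAtomic i, fun _ => hν⟩
    · exact ⟨Classical.arbitrary D, fun hi' => absurd hi' hi⟩
  choose a ha using hatom
  exact ⟨⟨a, fun i => w (Sum.inr i)⟩, fun | .inl i => ha i | .inr _ => fun _ => rfl⟩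

theorem Predicate.finite_vars (p : Predicate D) : p.vars.Finite :=
  Set.finite_iUnion fun i => (p.args i).finite_vars

theorem Atom.finite_vars : (a : Atom D) → a.vars.Finite
  | pred p => p.finite_vars
  | eqn e₁ e₂ => e₁.finite_vars.union e₂.finite_vars

theorem Rule.finite_vars (r : Rule D) : r.vars.Finite := by
  refine r.head.finite_vars.union ?_
  refine (r.body.finite_toSet.biUnion fun L _ => L.atom.finite_vars).subset ?_
  rintro v ⟨L, hL, hv⟩
  exact Set.mem_biUnion hL hv

/-! ### Literals over columns -/

/-- Literals whose variables are the columns `$1, …, $m` of an `m`-tuple. Both translations between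
Sequence Datalog and the algebra go through them. -/
inductive ColLiteral (D : Type u) (m : ℕ) : Type u
  | mem (R : RelName) (α : Fin R.arity → ColExpr D m)
  | notMem (R : RelName) (α : Fin R.arity → ColExpr D m)
  | eq (α β : ColExpr D m)
  | ne (α β : ColExpr D m)

/-- `t` satisfies the literal when its predicates are evaluated in `J`. -/
def ColLiteral.Sat (J : Instance D) {m : ℕ} (t : Tuple D m) : ColLiteral D m → Prop
  | mem R α => (fun i => (α i).apply t) ∈ J.rel R
  | notMem R α => (fun i => (α i).apply t) ∉ J.rel R
  | eq α β => α.apply t = β.apply t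
  | ne α β => α.apply t ≠ β.apply t

/-- Substitution of column expressions for the variables of a literal. -/
def Literal.toCol {m : ℕ} (s : Var → ColExpr D m) : Literal D → ColLiteral D m
  | pos (.pred p) => .mem p.name fun i => (p.args i).subst s
  | pos (.eqn e₁ e₂) => .eq (e₁.subst s) (e₂.subst s)
  | neg (.pred p) => .notMem p.name fun i => (p.args i).subst s
  | neg (.eqn e₁ e₂) => .ne (e₁.subst s) (e₂.subst s)

theorem Valuation.apply_subst {m : ℕ} {s : Var → ColExpr D m} {t : Tuple D m} {ν : Valuation D}
    {e : Expr D} (h : ∀ v ∈ e.vars, (s v).apply t = ν.val v) :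
    ColExpr.apply t (e.subst s) = ν.apply e :=
  PathExpr.eval_subst h

theorem Literal.sat_toCol {m : ℕ} {s : Var → ColExpr D m} {t : Tuple D m} {ν : Valuation D}
    {J : Instance D} {L : Literal D} (h : ∀ v ∈ L.atom.vars, (s v).apply t = ν.val v) :
    (L.toCol s).Sat J t ↔ L.Sat J ν := by
  have hpred (p : Predicate D) (hp : ∀ v ∈ p.vars, (s v).apply t = ν.val v) :
      (fun i => ColExpr.apply t ((p.args i).subst s)) = fun i => ν.apply (p.args i) :=
    funext fun i => Valuation.apply_subst fun v hv => hp v (Set.mem_iUnion_of_mem i hv)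
  rcases L with (p | ⟨e₁, e₂⟩) | (p | ⟨e₁, e₂⟩)
  · simp only [toCol, ColLiteral.Sat, hpred p h, Sat, Atom.Sat, Predicate.Sat]
  · simp only [toCol, ColLiteral.Sat, Sat, Atom.Sat,
      Valuation.apply_subst fun v hv => h v (Or.inl hv),
      Valuation.apply_subst fun v hv => h v (Or.inr hv)]
  · simp only [toCol, ColLiteral.Sat, hpred p h, Sat, Atom.Sat, Predicate.Sat]
  · simp only [toCol, ColLiteral.Sat, Sat, Atom.Sat, ne_eq,
      Valuation.apply_subst fun v hv => h v (Or.inl hv),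
      Valuation.apply_subst fun v hv => h v (Or.inr hv)]

/-! ### Finiteness of algebra expressions -/

theorem finite_substrings {α : Type*} (p : List α) : {s | s <:+: p}.Finite :=
  (List.finite_toSet p.sublists).subset fun _ hs => List.mem_sublists.2 hs.sublist

theorem AlgExpr.finite_eval (I : Instance D) {n : ℕ} (E : AlgExpr D Γ n) : (E.eval I).Finite := by
  induction E with
  | rel R _ => exact I.finite R
  | const C => exact C.finite_toSet
  | union E F ihE ihF => exact ihE.union ihF
  | diff E F ihE _ => exact ihE.sdiff
  | prod E F ihE ihF =>
    refine (ihE.image2 Fin.append ihF).subset ?_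
    rintro _ ⟨s, hs, t, ht, rfl⟩
    exact Set.mem_image2_of_mem hs ht
  | select α β E ih => exact ih.subset fun _ h => h.1
  | project α E ih =>
    refine (ih.image fun t j => (α j).apply t).subset ?_
    rintro _ ⟨t, ht, rfl⟩
    exact Set.mem_image_of_mem _ ht
  | unpack i E ih =>
    refine (ih.biUnion (t := fun t => {u | ∃ s : Path D, t i = [Value.pack s] ∧
      u = Function.update t i s}) fun t _ => Set.Subsingleton.finite ?_).subset ?_
    · rintro _ ⟨s, hs, rfl⟩ _ ⟨s', hs', rfl⟩
      simp_all
    · rintro u ⟨t, ht, h⟩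
      exact Set.mem_biUnion ht h
  | sub i E ih =>
    refine (ih.biUnion (t := fun t => (fun s => Fin.snoc (α := fun _ => Path D) t s) ''
      {s | s <:+: t i}) fun t _ => (finite_substrings _).image _).subset ?_
    rintro _ ⟨t, ht, s, hs, rfl⟩
    exact Set.mem_biUnion ht ⟨s, hs, rfl⟩

/-! ### Families of relations definable in the algebra -/

/-- The relations `X I` are the values of an algebra expression. -/
def Definable (Γ : Schema) {n : ℕ} (X : Instance D → Set (Tuple D n)) : Prop :=
  ∃ E : AlgExpr D Γ n, ∀ I, E.eval I = X I

theorem ColExpr.exists_apply_append {n : ℕ} (m : ℕ) (e : ColExpr D n) :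
    ∃ e' : ColExpr D (n + m), ∀ (s : Tuple D n) (t : Tuple D m),
      e'.apply (Fin.append s t) = e.apply s := by
  refine ⟨e.subst (Sum.elim (fun x => x.elim) fun i => .pvar (Fin.castAdd m i)), fun s t => ?_⟩
  refine PathExpr.eval_subst ?_
  rintro (x | i) -
  · exact x.elim
  · exact Fin.append_left s t i

namespace Definable

variable {n m : ℕ} {X Y : Instance D → Set (Tuple D n)}

theorem congr (hX : Definable Γ X) (h : ∀ I, X I = Y I) : Definable Γ Y :=
  (funext h : X = Y) ▸ hX

theorem const (C : Finset (Tuple D n)) : Definable Γ fun _ => {t | t ∈ C} :=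
  ⟨.const C, fun _ => rfl⟩

theorem empty : Definable Γ fun _ => (∅ : Set (Tuple D n)) :=
  (const ∅).congr fun _ => by simp

theorem union (hX : Definable Γ X) (hY : Definable Γ Y) : Definable Γ fun I => X I ∪ Y I := by
  obtain ⟨E, hE⟩ := hX
  obtain ⟨F, hF⟩ := hY
  exact ⟨.union E F, fun I => by simp only [AlgExpr.eval, hE, hF]⟩

theorem diff (hX : Definable Γ X) (hY : Definable Γ Y) : Definable Γ fun I => X I \ Y I := by
  obtain ⟨E, hE⟩ := hX
  obtain ⟨F, hF⟩ := hY
  exact ⟨.diff E F, fun I => by simp only [AlgExpr.eval, hE, hF]⟩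

theorem prod {Y : Instance D → Set (Tuple D m)} (hX : Definable Γ X) (hY : Definable Γ Y) :
    Definable Γ fun I => {u | ∃ s ∈ X I, ∃ t ∈ Y I, u = Fin.append s t} := by
  obtain ⟨E, hE⟩ := hX
  obtain ⟨F, hF⟩ := hY
  exact ⟨.prod E F, fun I => by simp only [AlgExpr.eval, hE, hF]⟩

theorem select (hX : Definable Γ X) (α β : ColExpr D n) :
    Definable Γ fun I => {t | t ∈ X I ∧ α.apply t = β.apply t} := by
  obtain ⟨E, hE⟩ := hX
  exact ⟨.select α β E, fun I => by simp only [AlgExpr.eval, hE]⟩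

theorem project (hX : Definable Γ X) (α : Fin m → ColExpr D n) :
    Definable Γ fun I => {u | ∃ t ∈ X I, u = fun j => (α j).apply t} := by
  obtain ⟨E, hE⟩ := hX
  exact ⟨.project α E, fun I => by simp only [AlgExpr.eval, hE]⟩

theorem unpack (hX : Definable Γ X) (i : Fin n) :
    Definable Γ fun I => {u | ∃ t ∈ X I, ∃ s : Path D, t i = [Value.pack s] ∧
      u = Function.update t i s} := by
  obtain ⟨E, hE⟩ := hX
  exact ⟨.unpack i E, fun I => by simp only [AlgExpr.eval, hE]⟩

theorem sub (hX : Definable Γ X) (i : Fin n) :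
    Definable Γ fun I => {u | ∃ t ∈ X I, ∃ s : Path D, s <:+: t i ∧
        u = Fin.snoc (α := fun _ => Path D) t s} := by
  obtain ⟨E, hE⟩ := hX
  exact ⟨.sub i E, fun I => by simp only [AlgExpr.eval, hE]⟩

theorem select_ne (hX : Definable Γ X) (α β : ColExpr D n) :
    Definable Γ fun I => {t | t ∈ X I ∧ α.apply t ≠ β.apply t} :=
  (hX.diff (hX.select α β)).congr fun I => by ext t; simp +contextual

theorem select_forall (hX : Definable Γ X) (α β : Fin m → ColExpr D n) :
    Definable Γ fun I => {t | t ∈ X I ∧ ∀ j, (α j).apply t = (β j).apply t} := by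
  induction m with
  | zero => exact hX.congr fun I => by simp
  | succ m ih =>
    refine ((ih (fun j => α j.succ) fun j => β j.succ).select (α 0) (β 0)).congr fun I => ?_
    ext t
    simp only [Set.mem_ofPred_eq, Fin.forall_fin_succ]
    tauto

theorem semijoin {Y : Instance D → Set (Tuple D m)} (hX : Definable Γ X) (hY : Definable Γ Y)
    (α : Fin m → ColExpr D n) :
    Definable Γ fun I => {t | t ∈ X I ∧ (fun j => (α j).apply t) ∈ Y I} := by
  choose α' hα' using fun j => (α j).exists_apply_append m
  have hleft (s : Tuple D n) (t : Tuple D m) :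
      (fun j => ColExpr.apply (Fin.append s t) (.pvar (Fin.castAdd m j))) = s :=
    funext (Fin.append_left s t)
  have hright (s : Tuple D n) (t : Tuple D m) (j : Fin m) :
      ColExpr.apply (Fin.append s t) (.pvar (Fin.natAdd n j)) = t j :=
    Fin.append_right s t j
  refine (((hX.prod hY).select_forall α' fun j => .pvar (Fin.natAdd n j)).project
    fun i : Fin n => .pvar (Fin.castAdd m i)).congr fun I => ?_
  ext u
  constructor
  · rintro ⟨_, ⟨⟨s, hs, t, ht, rfl⟩, h⟩, rfl⟩
    simp only [hα', hright, ← funext_iff] at h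
    rw [hleft]
    exact ⟨hs, h ▸ ht⟩
  · rintro ⟨hu, hα⟩
    exact ⟨_, ⟨⟨u, hu, _, hα, rfl⟩, fun j => by rw [hα', hright]⟩, (hleft _ _).symm⟩

theorem antijoin {Y : Instance D → Set (Tuple D m)} (hX : Definable Γ X) (hY : Definable Γ Y)
    (α : Fin m → ColExpr D n) :
    Definable Γ fun I => {t | t ∈ X I ∧ (fun j => (α j).apply t) ∉ Y I} :=
  (hX.diff (hX.semijoin hY α)).congr fun I => by ext t; simp +contextual

theorem pi {m : ℕ} {C : Fin m → Instance D → Set (Tuple D 1)} (hC : ∀ i, Definable Γ (C i)) :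
    Definable Γ fun I => {t : Tuple D m | ∀ i, (fun _ => t i) ∈ C i I} := by
  induction m with
  | zero => exact (const {Fin.elim0}).congr fun I => by ext t; simp [Subsingleton.elim t Fin.elim0]
  | succ m ih =>
    refine ((ih fun i => hC i.castSucc).prod (hC (Fin.last m))).congr fun I => ?_
    ext u
    simp only [Set.mem_ofPred_eq, Fin.forall_fin_succ', Fin.append_right_eq_snoc]
    constructor
    · rintro ⟨s, hs, t, ht, rfl⟩
      simp only [Fin.snoc_castSucc, Fin.snoc_last]
      exact ⟨hs, eq_const_of_unique t ▸ ht⟩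
    · rintro ⟨hinit, hlast⟩
      exact ⟨Fin.init u, hinit, _, hlast, (Fin.snoc_init_self u).symm⟩

theorem biUnion {ι : Type*} {l : List ι} {Z : ι → Instance D → Set (Tuple D n)}
    (h : ∀ i ∈ l, Definable Γ (Z i)) : Definable Γ fun I => ⋃ i ∈ l, Z i I := by
  induction l with
  | nil => exact empty.congr fun I => by simp
  | cons i l ih =>
    rw [List.forall_mem_cons] at h
    exact (h.1.union (ih h.2)).congr fun I => by simp [Set.iUnion_or, Set.iUnion_union_distrib]

end Definable

theorem exists_eq_atom_iff {p : Path D} : (∃ a, p = [Value.atom a]) ↔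
    p ≠ [] ∧ (¬ ∃ s, p = [Value.pack s]) ∧ ¬ ∃ s, s <:+: p ∧ s ≠ [] ∧ s ≠ p := by
  constructor
  · rintro ⟨a, rfl⟩
    refine ⟨by simp, by simp, ?_⟩
    rintro ⟨s, hs, hne, hne'⟩
    exact (List.sublist_singleton.1 hs.sublist).elim hne hne'
  · rintro ⟨hnil, hpack, hsub⟩
    match p with
    | [] => exact absurd rfl hnil
    | [.atom a] => exact ⟨a, rfl⟩
    | [.pack s] => exact absurd ⟨s, rfl⟩ hpack
    | x :: y :: q => exact absurd ⟨[x], ⟨[], y :: q, rfl⟩, by simp, by simp⟩ hsub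

namespace Definable

variable {X : Instance D → Set (Tuple D 1)}

theorem packed (hX : Definable Γ X) :
    Definable Γ fun I => {t | t ∈ X I ∧ ∃ s, t 0 = [Value.pack s]} := by
  refine ((hX.unpack 0).project fun _ : Fin 1 => .pack (.pvar 0)).congr fun I => ?_
  have hval {t : Tuple D 1} {s : Path D} (hs : t 0 = [Value.pack s]) :
      (fun _ => ColExpr.apply (Function.update t 0 s) (.pack (.pvar 0))) = t := by
    funext j
    rw [Subsingleton.elim j 0, hs]
    simp [ColExpr.apply, PathExpr.eval]
  ext t
  constructor
  · rintro ⟨_, ⟨t, ht, s, hs, rfl⟩, rfl⟩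
    rw [hval hs]
    exact ⟨ht, s, hs⟩
  · rintro ⟨ht, s, hs⟩
    exact ⟨_, ⟨t, ht, s, hs, rfl⟩, (hval hs).symm⟩

theorem proper_substring (hX : Definable Γ X) :
    Definable Γ fun I => {t | t ∈ X I ∧ ∃ s, s <:+: t 0 ∧ s ≠ [] ∧ s ≠ t 0} := by
  refine ((((hX.sub 0).select_ne (.pvar 1) .empty).select_ne (.pvar 1) (.pvar 0)).project
    fun _ : Fin 1 => .pvar 0).congr fun I => ?_
  have hval (t : Tuple D 1) (s : Path D) :
      (fun _ => ColExpr.apply (Fin.snoc (α := fun _ => Path D) t s) (.pvar 0)) = t :=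
    (eq_const_of_unique t).symm
  ext t
  constructor
  · rintro ⟨_, ⟨⟨⟨t, ht, s, hs, rfl⟩, hne⟩, hne'⟩, rfl⟩
    rw [hval]
    exact ⟨ht, s, hs, hne, hne'⟩
  · rintro ⟨ht, s, hs, hne, hne'⟩
    exact ⟨_, ⟨⟨⟨t, ht, s, hs, rfl⟩, hne⟩, hne'⟩, (hval t s).symm⟩

theorem atomic (hX : Definable Γ X) :
    Definable Γ fun I => {t | t ∈ X I ∧ ∃ a, t 0 = [Value.atom a]} := by
  refine (((hX.select_ne (.pvar 0) .empty).diff hX.packed).diff hX.proper_substring).congr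
    fun I => ?_
  ext t
  simp only [Set.mem_sdiff, Set.mem_ofPred_eq, ColExpr.apply, PathExpr.eval, exists_eq_atom_iff]
  grind

end Definable

/-! ### Instances of algebra expressions -/

/-- An algebra expression for each relation name: an instance that depends on an input instance of
`Γ` in a way definable in the algebra. -/
abbrev SymbolicInstance (D : Type u) (Γ : Schema) : Type u := (R : RelName) → AlgExpr D Γ R.arity

namespace SymbolicInstance

/-- The instance obtained by evaluating all expressions in the input instance `I`. -/
def eval (g : SymbolicInstance D Γ) (I : Instance D) : Instance D where
  rel R := (g R).eval I
  finite R := (g R).finite_eval I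

theorem definable (g : SymbolicInstance D Γ) (R : RelName) :
    Definable Γ fun I => (g.eval I).rel R :=
  ⟨g R, fun _ => rfl⟩

open Classical in
/-- The expressions that reproduce the input instance. -/
noncomputable def input (D : Type u) (Γ : Schema) : SymbolicInstance D Γ :=
  fun R => if h : R ∈ Γ then .rel R h else .const ∅

theorem eval_input {I : Instance D} (hI : I.Over Γ) : (input D Γ).eval I = I := by
  ext1
  funext R
  by_cases h : R ∈ Γ
  · simp [eval, input, h, AlgExpr.eval]
  · simp [eval, input, h, AlgExpr.eval, hI R h]

end SymbolicInstance

namespace Definable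

variable {m : ℕ} {Z : Instance D → Set (Tuple D m)}

theorem filter_literal (g : SymbolicInstance D Γ) (hZ : Definable Γ Z) :
    (L : ColLiteral D m) → Definable Γ fun I => {t | t ∈ Z I ∧ L.Sat (g.eval I) t}
  | .mem R α => hZ.semijoin (g.definable R) α
  | .notMem R α => hZ.antijoin (g.definable R) α
  | .eq α β => hZ.select α β
  | .ne α β => hZ.select_ne α β

theorem filter (g : SymbolicInstance D Γ) (hZ : Definable Γ Z) (body : List (ColLiteral D m)) :
    Definable Γ fun I => {t | t ∈ Z I ∧ ∀ L ∈ body, L.Sat (g.eval I) t} := by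
  induction body with
  | nil => exact hZ.congr fun I => by simp
  | cons L body ih =>
    refine (ih.filter_literal g L).congr fun I => ?_
    ext t
    simp only [Set.mem_ofPred_eq, List.forall_mem_cons]
    tauto

end Definable

/-! ### Definable bounds for the values of variables -/

/-- The values `h ν` of the valuations with `Φ I ν` are bounded by a definable unary relation. -/
def Bounded (Γ : Schema) (Φ : Instance D → Valuation D → Prop) (h : Valuation D → Path D) : Prop :=
  ∃ C : Instance D → Set (Tuple D 1), Definable Γ C ∧ ∀ I ν, Φ I ν → (fun _ => h ν) ∈ C I

theorem Bounded.congr {Φ : Instance D → Valuation D → Prop} {h h' : Valuation D → Path D}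
    (hb : Bounded Γ Φ h) (heq : ∀ I ν, Φ I ν → h ν = h' ν) : Bounded Γ Φ h' := by
  obtain ⟨C, hC, hb⟩ := hb
  exact ⟨C, hC, fun I ν hν => heq I ν hν ▸ hb I ν hν⟩

theorem Bounded.apply {Φ : Instance D → Valuation D → Prop} {e : Expr D}
    (h : ∀ v ∈ e.vars, Bounded Γ Φ (·.val v)) : Bounded Γ Φ (·.apply e) := by
  induction e with
  | const a => exact ⟨_, .const {fun _ => [Value.atom a]}, fun I ν _ => by
      simp [Valuation.apply, PathExpr.eval]⟩
  | avar x => exact h _ rfl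
  | pvar x => exact h _ rfl
  | pack e ih =>
    obtain ⟨C, hC, hb⟩ := ih h
    exact ⟨_, hC.project fun _ => .pack (.pvar 0), fun I ν hν => ⟨_, hb I ν hν, rfl⟩⟩
  | empty => exact ⟨_, .const {fun _ => []}, fun I ν _ => by
      simp [Valuation.apply, PathExpr.eval]⟩
  | concat e₁ e₂ ih₁ ih₂ =>
    obtain ⟨C₁, hC₁, hb₁⟩ := ih₁ fun v hv => h v (Or.inl hv)
    obtain ⟨C₂, hC₂, hb₂⟩ := ih₂ fun v hv => h v (Or.inr hv)
    exact ⟨_, (hC₁.prod hC₂).project fun _ => .concat (.pvar 0) (.pvar 1),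
      fun I ν hν => ⟨_, ⟨_, hb₁ I ν hν, _, hb₂ I ν hν, rfl⟩, rfl⟩⟩

theorem Bounded.sub {Φ : Instance D → Valuation D → Prop} {h h' : Valuation D → Path D}
    (hb : Bounded Γ Φ h) (hsub : ∀ ν, h' ν <:+: h ν) : Bounded Γ Φ h' := by
  obtain ⟨C, hC, hb⟩ := hb
  refine ⟨_, (hC.sub 0).project fun _ => .pvar 1,
    fun I ν hν => ⟨_, ⟨_, hb I ν hν, _, hsub ν, rfl⟩, ?_⟩⟩
  simp [ColExpr.apply, PathExpr.eval, Fin.snoc]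

theorem Bounded.of_mem_vars {Φ : Instance D → Valuation D → Prop} {e : Expr D}
    (h : Bounded Γ Φ (·.apply e)) {v : Var} (hv : v ∈ e.vars) : Bounded Γ Φ (·.val v) := by
  induction e with
  | const _ => exact hv.elim
  | avar x => cases hv; exact h
  | pvar x => cases hv; exact h
  | pack e ih =>
    refine ih ?_ hv
    obtain ⟨C, hC, hb⟩ := h
    refine ⟨_, hC.unpack 0, fun I ν hν => ⟨_, hb I ν hν, _, rfl, ?_⟩⟩
    funext j
    rw [Subsingleton.elim j 0]
    simp [Valuation.apply]
  | empty => exact hv.elim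
  | concat e₁ e₂ ih₁ ih₂ =>
    rcases hv with hv | hv
    · exact ih₁ (h.sub fun ν => ⟨[], e₂.eval ν.onAtomic ν.onPath, rfl⟩) hv
    · exact ih₂ (h.sub fun ν => ⟨e₁.eval ν.onAtomic ν.onPath, [], List.append_nil _⟩) hv

theorem Bounded.exists_possible [Nonempty D] {Φ : Instance D → Valuation D → Prop} {v : Var}
    (h : Bounded Γ Φ (·.val v)) :
    ∃ C : Instance D → Set (Tuple D 1), Definable Γ C ∧
      (∀ I ν, Φ I ν → (fun _ => ν.val v) ∈ C I) ∧
      ∀ I, ∀ t ∈ C I, ∃ ν : Valuation D, ν.val v = t 0 := by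
  obtain ⟨C, hC, hb⟩ := h
  rcases v with i | i
  · refine ⟨_, hC.atomic, fun I ν hν => ⟨hb I ν hν, ν.onAtomic i, rfl⟩, ?_⟩
    rintro I t ⟨-, a, ha⟩
    exact ⟨⟨fun _ => a, fun _ => []⟩, ha.symm⟩
  · exact ⟨C, hC, hb, fun I t _ => ⟨⟨fun _ => Classical.arbitrary D, fun _ => t 0⟩, rfl⟩⟩

theorem Rule.Limited.bounded (g : SymbolicInstance D Γ) {r : Rule D} {v : Var}
    (hv : r.Limited v) : Bounded Γ (fun I ν => ∀ L ∈ r.body, L.Sat (g.eval I) ν) (·.val v) := by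
  induction hv with
  | ofPred p v hp hv =>
    obtain ⟨i, hi⟩ := Set.mem_iUnion.1 hv
    refine Bounded.of_mem_vars ?_ hi
    exact ⟨_, (g.definable p.name).project fun _ => .pvar i, fun I ν hν => ⟨_, hν _ hp, rfl⟩⟩
  | ofLeft _ _ _ he _ hv ih =>
    exact ((Bounded.apply ih).congr fun _ _ hν => hν _ he).of_mem_vars hv
  | ofRight _ _ _ he _ hv ih =>
    exact ((Bounded.apply ih).congr fun _ _ hν => (hν _ he).symm).of_mem_vars hv

/-! ### Immediate consequences -/

/-- The fact `ν(p)`. -/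
def Predicate.fact (ν : Valuation D) (p : Predicate D) : Σ R : RelName, Tuple D R.arity :=
  ⟨p.name, fun i => ν.apply (p.args i)⟩

/-- The facts on `R` that a rule derives from `J` in one step. -/
def Rule.consequences (r : Rule D) (J : Instance D) (R : RelName) : Set (Tuple D R.arity) :=
  {t | ∃ ν : Valuation D, (∀ L ∈ r.body, L.Sat J ν) ∧ r.head.fact ν = ⟨R, t⟩}

/-- The facts on `R` that the rules of a stratum derive from `J` in one step. -/
def Stratum.consequences (S : Stratum D) (J : Instance D) (R : RelName) :
    Set (Tuple D R.arity) :=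
  ⋃ r ∈ S, r.consequences J R

theorem Rule.mem_consequences_head {r : Rule D} {J : Instance D} {t : Tuple D r.head.name.arity} :
    t ∈ r.consequences J r.head.name ↔
      ∃ ν : Valuation D, (∀ L ∈ r.body, L.Sat J ν) ∧ t = fun i => ν.apply (r.head.args i) := by
  simp only [consequences, Predicate.fact, Sigma.mk.injEq, heq_eq_eq, true_and,
    Set.mem_ofPred_eq, eq_comm]

theorem Rule.consequences_eq_empty {r : Rule D} {R : RelName} (h : r.head.name ≠ R)
    (J : Instance D) : r.consequences J R = ∅ :=
  Set.eq_empty_of_forall_notMem fun _ ⟨_, _, hν⟩ => h (congrArg Sigma.fst hν)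

theorem Rule.forall_sat_toCol (r : Rule D) {m : ℕ} {s : Var → ColExpr D m} {t : Tuple D m}
    {ν : Valuation D} {J : Instance D} (h : ∀ v ∈ r.vars, (s v).apply t = ν.val v) :
    (∀ L ∈ r.body.map (Literal.toCol s), L.Sat J t) ↔ ∀ L ∈ r.body, L.Sat J ν := by
  rw [List.forall_mem_map]
  exact forall₂_congr fun L hL => Literal.sat_toCol fun v hv => h v (Or.inr ⟨L, hL, hv⟩)

theorem Rule.apply_head_subst (r : Rule D) {m : ℕ} {s : Var → ColExpr D m} {t : Tuple D m}
    {ν : Valuation D} (h : ∀ v ∈ r.vars, (s v).apply t = ν.val v) :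
    (fun j => ColExpr.apply t ((r.head.args j).subst s)) = fun j => ν.apply (r.head.args j) :=
  funext fun j => Valuation.apply_subst fun v hv => h v (Or.inl (Set.mem_iUnion_of_mem j hv))

open Classical in
theorem Rule.Safe.definable_consequences_head [Nonempty D] {r : Rule D} (hr : r.Safe)
    (g : SymbolicInstance D Γ) :
    Definable Γ fun I => r.consequences (g.eval I) r.head.name := by
  obtain ⟨m, ⟨c⟩⟩ := @Finite.exists_equiv_fin r.vars r.finite_vars
  choose C hC hsound hpossible using
    fun i => ((hr _ (c.symm i).2).bounded g).exists_possible
  let s (v : Var) : ColExpr D m := if h : v ∈ r.vars then .pvar (c ⟨v, h⟩) else .empty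
  have hs (t : Tuple D m) (v : Var) (hv : v ∈ r.vars) : (s v).apply t = t (c ⟨v, hv⟩) := by
    simp [s, hv, ColExpr.apply, PathExpr.eval]
  refine (((Definable.pi hC).filter g (r.body.map (Literal.toCol s))).project
    fun j => (r.head.args j).subst s).congr fun I => ?_
  ext u
  rw [mem_consequences_head]
  constructor
  · rintro ⟨t, ⟨ht, hL⟩, rfl⟩
    obtain ⟨ν, hν⟩ : ∃ ν : Valuation D, ∀ v ∈ r.vars, ν.val v = (s v).apply t := by
      refine Valuation.exists_forall_val_eq fun v hv => ?_
      obtain ⟨ν, hν⟩ := hpossible _ I _ (ht (c ⟨v, hv⟩))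
      exact ⟨ν, by simpa [hs t v hv] using hν⟩
    have hsν (v) (hv : v ∈ r.vars) : (s v).apply t = ν.val v := (hν v hv).symm
    exact ⟨ν, (r.forall_sat_toCol hsν).1 hL, r.apply_head_subst hsν⟩
  · rintro ⟨ν, hν, rfl⟩
    have hsν (v) (hv : v ∈ r.vars) : (s v).apply (fun i => ν.val (c.symm i)) = ν.val v := by
      simp [hs _ v hv]
    exact ⟨_, ⟨fun i => hsound i I ν hν, (r.forall_sat_toCol hsν).2 hν⟩,
      (r.apply_head_subst hsν).symm⟩

theorem Rule.Safe.definable_consequences [Nonempty D] {r : Rule D} (hr : r.Safe)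
    (g : SymbolicInstance D Γ) (R : RelName) :
    Definable Γ fun I => r.consequences (g.eval I) R := by
  by_cases hR : r.head.name = R
  · subst hR
    exact hr.definable_consequences_head g
  · exact Definable.empty.congr fun I => (r.consequences_eq_empty hR _).symm

theorem Stratum.definable_consequences [Nonempty D] {S : Stratum D} (hS : ∀ r ∈ S, r.Safe)
    (g : SymbolicInstance D Γ) (R : RelName) :
    Definable Γ fun I => S.consequences (g.eval I) R :=
  Definable.biUnion fun r hr => (hS r hr).definable_consequences g R

theorem Literal.Sat.mono {L : Literal D} {J K : Instance D} {ν : Valuation D} (h : L.Sat J ν)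
    (hpos : ∀ p, L = .pos (.pred p) → J.rel p.name ⊆ K.rel p.name)
    (hneg : ∀ p, L = .neg (.pred p) → K.rel p.name ⊆ J.rel p.name) : L.Sat K ν := by
  rcases L with (p | ⟨e₁, e₂⟩) | (p | ⟨e₁, e₂⟩)
  · exact hpos p rfl h
  · exact h
  · exact fun hK => h (hneg p rfl hK)
  · exact h

theorem Rule.satisfiedIn_iff {r : Rule D} {K : Instance D} :
    r.SatisfiedIn K ↔ ∀ R, r.consequences K R ⊆ K.rel R := by
  constructor
  · rintro h R t ⟨ν, hν, ht⟩
    cases ht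
    exact h ν hν
  · exact fun h ν hν => h _ ⟨ν, hν, rfl⟩

/-! ### Semipositive strata -/

namespace Stratum

variable {S : Stratum D} {I J K : Instance D} {R : RelName}

theorem mem_consequences {t : Tuple D R.arity} :
    t ∈ S.consequences J R ↔ ∃ r ∈ S, t ∈ r.consequences J R := by
  simp only [consequences, Set.mem_iUnion, exists_prop]

theorem consequences_eq_empty (hR : R ∉ S.heads) (J : Instance D) : S.consequences J R = ∅ := by
  refine Set.eq_empty_of_forall_notMem fun t ht => ?_
  obtain ⟨r, hr, ν, -, hν⟩ := mem_consequences.1 ht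
  exact hR ⟨r, hr, congrArg Sigma.fst hν⟩

theorem forall_satisfiedIn_iff :
    (∀ r ∈ S, r.SatisfiedIn K) ↔ ∀ R, S.consequences K R ⊆ K.rel R := by
  simp only [consequences, Set.iUnion_subset_iff, Rule.satisfiedIn_iff]
  exact ⟨fun h R r hr => h r hr R, fun h r hr R => h R r hr⟩

theorem consequences_subset
    (hpos : ∀ r ∈ S, r.head.name = R → ∀ p, .pos (.pred p) ∈ r.body →
      J.rel p.name ⊆ K.rel p.name)
    (hneg : ∀ r ∈ S, r.head.name = R → ∀ p, .neg (.pred p) ∈ r.body →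
      K.rel p.name ⊆ J.rel p.name) :
    S.consequences J R ⊆ S.consequences K R := by
  intro t ht
  obtain ⟨r, hr, ν, hν, hhead⟩ := mem_consequences.1 ht
  have hR : r.head.name = R := congrArg Sigma.fst hhead
  refine mem_consequences.2 ⟨r, hr, ν, fun L hL => (hν L hL).mono ?_ ?_, hhead⟩
  · rintro p rfl
    exact hpos r hr hR p hL
  · rintro p rfl
    exact hneg r hr hR p hL

theorem consequences_congr
    (h : ∀ r ∈ S, r.head.name = R → ∀ R', r.Uses R' → J.rel R' = K.rel R') :
    S.consequences J R = S.consequences K R :=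
  (consequences_subset (fun r hr hR p hp => (h r hr hR _ ⟨_, hp, p, rfl, rfl⟩).subset)
    fun r hr hR p hp => (h r hr hR _ ⟨_, hp, p, rfl, rfl⟩).superset).antisymm
  (consequences_subset (fun r hr hR p hp => (h r hr hR _ ⟨_, hp, p, rfl, rfl⟩).superset)
    fun r hr hR p hp => (h r hr hR _ ⟨_, hp, p, rfl, rfl⟩).subset)

/-- Negated predicates of the stratum are not heads of the stratum, so that its immediate
consequence operator is monotone. -/
def Semipositive (S : Stratum D) : Prop :=
  ∀ r ∈ S, ∀ p : Predicate D, .neg (.pred p) ∈ r.body → p.name ∉ S.heads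

theorem Semipositive.consequences_mono (hS : S.Semipositive) (hle : J ≤ K)
    (heq : ∀ R ∉ S.heads, K.rel R = J.rel R) (R : RelName) :
    S.consequences J R ⊆ S.consequences K R :=
  consequences_subset (fun _ _ _ p _ => hle p.name)
    fun r hr _ p hp => (heq p.name (hS r hr p hp)).subset

theorem IsResult.rel_eq_union_consequences (h : S.IsResult I J) (hS : S.Semipositive)
    (R : RelName) : J.rel R = I.rel R ∪ S.consequences J R := by
  obtain ⟨⟨hIJ, hoff, hsat⟩, hleast⟩ := h
  have hsub (R) : I.rel R ∪ S.consequences J R ⊆ J.rel R :=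
    Set.union_subset (hIJ R) (forall_satisfiedIn_iff.1 hsat R)
  let K : Instance D :=
    ⟨fun R => I.rel R ∪ S.consequences J R, fun R => (J.finite R).subset (hsub R)⟩
  have hKoff (R) (hR : R ∉ S.heads) : K.rel R = I.rel R := by
    simp only [K, consequences_eq_empty hR, Set.union_empty]
  have hKcons (R) : S.consequences K R ⊆ K.rel R :=
    (hS.consequences_mono hsub (fun R hR => (hoff R hR).trans (hKoff R hR).symm) R).trans
      Set.subset_union_right
  have hJK : J ≤ K :=
    hleast ⟨fun R => Set.subset_union_left, hKoff, forall_satisfiedIn_iff.2 hKcons⟩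
  exact (hJK R).antisymm (hsub R)

/-! ### Results of nonrecursive strata -/

/-- `R'` is a head of the stratum that occurs in the body of a rule with head `R`. -/
def Precedes (S : Stratum D) (R' R : RelName) : Prop :=
  R' ∈ S.heads ∧ ∃ r ∈ S, r.head.name = R ∧ r.Uses R'

theorem Semipositive.isResult_of_rel_eq (hS : S.Semipositive) (hwf : WellFounded S.Precedes)
    (h : ∀ R, J.rel R = I.rel R ∪ S.consequences J R) : S.IsResult I J := by
  have hoff (R) (hR : R ∉ S.heads) : J.rel R = I.rel R := by
    rw [h R, consequences_eq_empty hR, Set.union_empty]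
  refine ⟨⟨fun R => ?_, hoff, forall_satisfiedIn_iff.2 fun R => ?_⟩, ?_⟩
  · exact (h R).symm ▸ Set.subset_union_left
  · exact (h R).symm ▸ Set.subset_union_right
  rintro K ⟨hIK, hKoff, hKsat⟩ R
  induction R using hwf.induction with
  | _ R ih =>
  rw [h R]
  refine Set.union_subset (hIK R) (subset_trans ?_ (forall_satisfiedIn_iff.1 hKsat R))
  refine consequences_subset (fun r hr hR p hp => ?_) fun r hr _ p hp => ?_
  · by_cases hhead : p.name ∈ S.heads
    · exact ih _ ⟨hhead, r, hr, hR, _, hp, p, rfl, rfl⟩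
    · exact (hoff _ hhead).subset.trans (hIK _)
  · have hhead := hS r hr p hp
    rw [hKoff _ hhead, hoff _ hhead]

open Classical in
theorem exists_symbolicInstance [Nonempty D] (hsafe : ∀ r ∈ S, r.Safe) (hS : S.Semipositive)
    (hwf : WellFounded S.Precedes) (g : SymbolicInstance D Γ) :
    ∃ h : SymbolicInstance D Γ, ∀ I, S.IsResult (g.eval I) (h.eval I) := by
  choose next hnext using fun (g' : SymbolicInstance D Γ) (R : RelName) =>
    (g.definable R).union (definable_consequences hsafe g' R)
  let h : SymbolicInstance D Γ := hwf.fix fun R ih =>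
    next (fun R' => if hR : S.Precedes R' R then ih R' hR else g R') R
  let below (R : RelName) : SymbolicInstance D Γ :=
    fun R' => if S.Precedes R' R then h R' else g R'
  have hfix (R) : h R = next (below R) R := hwf.fix_eq _ R
  have heval (I) (R) : (h.eval I).rel R = (g.eval I).rel R ∪ S.consequences ((below R).eval I) R :=
    (congrArg (AlgExpr.eval I) (hfix R)).trans (hnext (below R) R I)
  have hoff (I) (R) (hR : R ∉ S.heads) : (h.eval I).rel R = (g.eval I).rel R := by
    rw [heval, consequences_eq_empty hR, Set.union_empty]
  refine ⟨h, fun I => hS.isResult_of_rel_eq hwf fun R => (heval I R).trans ?_⟩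
  congr 1
  refine consequences_congr fun r hr hR R' hR' => ?_
  by_cases hprec : S.Precedes R' R
  · simp only [SymbolicInstance.eval, below, if_pos hprec]
  · have hR'off : R' ∉ S.heads := fun hhead => hprec ⟨hhead, r, hr, hR, hR'⟩
    rw [hoff I R' hR'off]
    simp only [SymbolicInstance.eval, below, if_neg hprec]

end Stratum

theorem Stratified.semipositive {Q : List (Stratum D)} (hQ : Stratified Q) {S : Stratum D}
    (hS : S ∈ Q) : S.Semipositive := by
  induction Q with
  | nil => cases hS
  | cons S' Q ih =>
    rcases List.mem_cons.1 hS with rfl | hS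
    · exact fun r hr p hp => hQ.1 r hr p hp S List.mem_cons_self
    · exact ih hQ.2 hS

theorem StrataResult.exists_symbolicInstance [Nonempty D] {Q : List (Stratum D)}
    (hsafe : ∀ S ∈ Q, ∀ r ∈ S, r.Safe) (hsemi : ∀ S ∈ Q, S.Semipositive)
    (hwf : ∀ S ∈ Q, WellFounded S.Precedes) (g : SymbolicInstance D Γ) :
    ∃ h : SymbolicInstance D Γ, ∀ I, StrataResult Q (g.eval I) (h.eval I) := by
  induction Q generalizing g with
  | nil => exact ⟨g, fun _ => rfl⟩
  | cons S Q ih =>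
    rw [List.forall_mem_cons] at hsafe hsemi hwf
    obtain ⟨g', hg'⟩ := Stratum.exists_symbolicInstance hsafe.1 hsemi.1 hwf.1 g
    obtain ⟨h, hh⟩ := ih hsafe.2 hsemi.2 hwf.2 g'
    exact ⟨h, fun I => ⟨_, hg' I, hh I⟩⟩

namespace Program

theorem finite_idb (P : Program D) : P.idb.Finite := by
  refine (P.strata.flatten.finite_toSet.image fun r => r.head.name).subset ?_
  rintro R ⟨r, ⟨S, hS, hr⟩, rfl⟩
  exact ⟨r, List.mem_flatten.2 ⟨S, hS, hr⟩, rfl⟩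

theorem Nonrecursive.wellFounded {P : Program D} (hP : P.Nonrecursive) :
    WellFounded (Function.swap P.DependsOn) := by
  let lt : RelName → RelName → Prop := Function.swap (Relation.TransGen P.DependsOn)
  have : IsStrictOrder RelName lt :=
    { irrefl := hP, trans := fun _ _ _ h h' => Relation.TransGen.trans h' h }
  exact Subrelation.wf (fun h => ⟨.single h, h.2.1, h.1⟩)
    (Set.wellFoundedOn_iff.1 (P.finite_idb.wellFoundedOn (r := lt)))

theorem Nonrecursive.exists_symbolicInstance [Nonempty D] {P : Program D} (hP : P.Nonrecursive)
    (Γ : Schema) : ∃ h : SymbolicInstance D Γ, ∀ I, I.Over Γ → P.IsResult I (h.eval I) := by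
  have hwf (S) (hS : S ∈ P.strata) : WellFounded S.Precedes := by
    refine Subrelation.wf ?_ hP.wellFounded
    rintro R' R ⟨⟨r', hr', hR'⟩, r, hr, hR, hu⟩
    exact ⟨⟨r, ⟨S, hS, hr⟩, hR⟩, ⟨r', ⟨S, hS, hr'⟩, hR'⟩, r, ⟨S, hS, hr⟩, hR, hu⟩
  obtain ⟨h, hh⟩ := StrataResult.exists_symbolicInstance P.safe
    (fun S hS => P.stratified.semipositive hS) hwf (SymbolicInstance.input D Γ)
  refine ⟨h, fun I hI => ?_⟩
  have := hh I
  rwa [SymbolicInstance.eval_input hI] at this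

theorem Nonrecursive.exists_algExpr [Nonempty D] {P : Program D} (hP : P.Nonrecursive)
    (Γ : Schema) (T : RelName) :
    ∃ E : AlgExpr D Γ T.arity, ∀ I : Instance D, I.Over Γ →
      ∃ J, P.IsResult I J ∧ J.rel T = E.eval I := by
  obtain ⟨g, hg⟩ := hP.exists_symbolicInstance Γ
  exact ⟨g T, fun I hI => ⟨g.eval I, hg I hI, rfl⟩⟩

end Program

/-! ### Rules over columns -/

section ColRule

variable {m n : ℕ}

/-- The values of the first `m` path variables, as a tuple. -/
def Valuation.columns (ν : Valuation D) (m : ℕ) : Tuple D m := fun i => ν.onPath i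

theorem Valuation.columns_surjective [Nonempty D] (m : ℕ) :
    Function.Surjective fun ν : Valuation D => ν.columns m := fun t =>
  ⟨⟨fun _ => Classical.arbitrary D, fun i => if h : i < m then t ⟨i, h⟩ else []⟩,
    funext fun i => by simp [columns]⟩

/-- The path expression of Sequence Datalog in which the column `$i` is the path variable `i`. -/
def ColExpr.toExpr (α : ColExpr D m) : Expr D :=
  α.subst (Sum.elim (fun x : Empty => x.elim) fun i : Fin m => .pvar (i : ℕ))

theorem Valuation.apply_toExpr (ν : Valuation D) (α : ColExpr D m) :
    ν.apply α.toExpr = α.apply (ν.columns m) := by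
  refine PathExpr.eval_subst ?_
  rintro (x | i) -
  · exact x.elim
  · rfl

theorem ColExpr.mem_vars_toExpr {α : ColExpr D m} {v : Var} :
    v ∈ α.toExpr.vars ↔ ∃ i : Fin m, Sum.inr i ∈ α.vars ∧ v = Sum.inr ↑i := by
  simp only [toExpr, PathExpr.vars_subst, Set.mem_iUnion, Sum.exists, IsEmpty.exists_iff, false_or,
    Sum.elim_inr, PathExpr.vars, Set.mem_singleton_iff, exists_prop]

namespace ColLiteral

/-- The literal of Sequence Datalog in which the column `$i` is the path variable `i`. -/
def toLiteral : ColLiteral D m → Literal D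
  | mem R α => .pos (.pred ⟨R, fun i => (α i).toExpr⟩)
  | notMem R α => .neg (.pred ⟨R, fun i => (α i).toExpr⟩)
  | eq α β => .pos (.eqn α.toExpr β.toExpr)
  | ne α β => .neg (.eqn α.toExpr β.toExpr)

theorem sat_toLiteral {J : Instance D} {ν : Valuation D} {L : ColLiteral D m} :
    L.toLiteral.Sat J ν ↔ L.Sat J (ν.columns m) := by
  cases L <;>
    simp only [toLiteral, Literal.Sat, Atom.Sat, Predicate.Sat, Sat, Valuation.apply_toExpr, ne_eq]

theorem exists_eq_inr_of_mem_vars_toLiteral {L : ColLiteral D m} {v : Var}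
    (hv : v ∈ L.toLiteral.atom.vars) : ∃ i : Fin m, v = Sum.inr ↑i := by
  cases L <;>
    simp only [toLiteral, Literal.atom, Atom.vars, Predicate.vars, Set.mem_iUnion, Set.mem_union,
      ColExpr.mem_vars_toExpr] at hv <;> grind

/-- The relation name `R` occurs in the literal. -/
def Uses (R : RelName) : ColLiteral D m → Prop
  | mem R' _ => R = R'
  | notMem R' _ => R = R'
  | eq _ _ => False
  | ne _ _ => False

theorem uses_of_atom_toLiteral {L : ColLiteral D m} {p : Predicate D}
    (h : L.toLiteral.atom = .pred p) : L.Uses p.name := by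
  cases L <;> cases h <;> rfl

end ColLiteral

/-- Rules without head relation name whose variables are the columns `$1, …, $m`, with `n` path
expressions in the head. -/
structure ColRule (D : Type u) (m n : ℕ) where
  head : Fin n → ColExpr D m
  body : List (ColLiteral D m)

namespace ColRule

variable {q : ColRule D m n}

/-- The `n`-tuples that the rule derives from `J` in one step. -/
def eval (q : ColRule D m n) (J : Instance D) : Set (Tuple D n) :=
  {u | ∃ t : Tuple D m, (∀ L ∈ q.body, L.Sat J t) ∧ u = fun j => (q.head j).apply t}

/-- The rule of Sequence Datalog with head relation name `⟨k, n⟩`. -/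
def toRule (k : ℕ) (q : ColRule D m n) : Rule D :=
  ⟨⟨⟨k, n⟩, fun j => (q.head j).toExpr⟩, q.body.map ColLiteral.toLiteral⟩

theorem consequences_toRule [Nonempty D] (k : ℕ) (q : ColRule D m n) (J : Instance D) :
    (q.toRule k).consequences J ⟨k, n⟩ = q.eval J := by
  ext u
  refine Rule.mem_consequences_head.trans ?_
  simp only [eval, Set.mem_ofPred_eq, (Valuation.columns_surjective m).exists, toRule,
    List.forall_mem_map, ColLiteral.sat_toLiteral, Valuation.apply_toExpr]

/-- The relation name `R` occurs in the body. -/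
def Uses (q : ColRule D m n) (R : RelName) : Prop := ∃ L ∈ q.body, L.Uses R

theorem uses_of_uses_toRule {k : ℕ} {R : RelName} (h : (q.toRule k).Uses R) : q.Uses R := by
  obtain ⟨_, hL, p, hp, rfl⟩ := h
  obtain ⟨L, hLq, rfl⟩ := List.mem_map.1 hL
  exact ⟨L, hLq, ColLiteral.uses_of_atom_toLiteral hp⟩

/-- The column `$i` is a limited variable. -/
def Limited (q : ColRule D m n) (i : Fin m) : Prop := ∀ k, (q.toRule k).Limited (Sum.inr ↑i)

theorem limited_of_mem {R : RelName} {α : Fin R.arity → ColExpr D m} (h : .mem R α ∈ q.body)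
    {j : Fin R.arity} {i : Fin m} (hi : Sum.inr i ∈ (α j).vars) : q.Limited i := fun _ =>
  .ofPred _ _ (List.mem_map_of_mem h)
    (Set.mem_iUnion_of_mem j (ColExpr.mem_vars_toExpr.2 ⟨i, hi, rfl⟩))

theorem limited_of_mem_pvar (R : RelName) (f : Fin R.arity → Fin m)
    (h : .mem R (fun j => .pvar (f j)) ∈ q.body) (j : Fin R.arity) : q.Limited (f j) :=
  limited_of_mem h (j := j) rfl

theorem limited_of_eq {α β : ColExpr D m} (h : .eq α β ∈ q.body)
    (hα : ∀ i, Sum.inr i ∈ α.vars → q.Limited i) {i : Fin m} (hi : Sum.inr i ∈ β.vars) :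
    q.Limited i := by
  refine fun k => .ofLeft _ _ _ (List.mem_map_of_mem h) (fun v hv => ?_)
    (ColExpr.mem_vars_toExpr.2 ⟨i, hi, rfl⟩)
  obtain ⟨j, hj, rfl⟩ := ColExpr.mem_vars_toExpr.1 hv
  exact hα j hj k

theorem safe_toRule (h : ∀ i, q.Limited i) (k : ℕ) : (q.toRule k).Safe := by
  intro v hv
  obtain ⟨i, rfl⟩ : ∃ i : Fin m, v = Sum.inr ↑i := by
    rcases hv with hv | ⟨L, hL, hv⟩
    · obtain ⟨j, hj⟩ := Set.mem_iUnion.1 hv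
      exact (ColExpr.mem_vars_toExpr.1 hj).imp fun _ => And.right
    · obtain ⟨L, -, rfl⟩ := List.mem_map.1 hL
      exact ColLiteral.exists_eq_inr_of_mem_vars_toLiteral hv
  exact h i k

end ColRule

end ColRule

/-! ### Extending a program by one stratum -/

theorem Stratified.concat {Q : List (Stratum D)} {S : Stratum D} (hQ : Stratified Q)
    (h : ∀ S' ∈ Q ++ [S], ∀ r ∈ S', ∀ p : Predicate D, .neg (.pred p) ∈ r.body →
      p.name ∉ S.heads) : Stratified (Q ++ [S]) := by
  induction Q with
  | nil => exact ⟨fun r hr p hp => by simpa using h S (by simp) r hr p hp, trivial⟩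
  | cons S₀ Q ih =>
    rw [List.cons_append, List.forall_mem_cons] at h
    refine ⟨fun r hr p hp S' hS' => ?_, ih hQ.2 h.2⟩
    rcases List.mem_append.1 (show S' ∈ (S₀ :: Q) ++ [S] from hS') with hS' | hS'
    · exact hQ.1 r hr p hp S' hS'
    · exact List.mem_singleton.1 hS' ▸ h.1 r hr p hp

theorem strataResult_concat {Q : List (Stratum D)} {S : Stratum D} {I J : Instance D} :
    StrataResult (Q ++ [S]) I J ↔ ∃ K, StrataResult Q I K ∧ S.IsResult K J := by
  induction Q generalizing I with
  | nil => simp [StrataResult]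
  | cons S' Q ih =>
    simp only [List.cons_append, StrataResult, ih]
    exact ⟨fun ⟨K, hK, K', hK', h⟩ => ⟨K', ⟨K, hK, hK'⟩, h⟩,
      fun ⟨K', ⟨K, hK, hK'⟩, h⟩ => ⟨K, hK, K', hK', h⟩⟩

theorem StrataResult.rel_eq {Q : List (Stratum D)} {I J : Instance D} (h : StrataResult Q I J)
    {R : RelName} (hR : ∀ S ∈ Q, R ∉ S.heads) : J.rel R = I.rel R := by
  induction Q generalizing I with
  | nil => rw [show J = I from h]
  | cons S Q ih =>
    obtain ⟨K, hK, h⟩ := h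
    rw [List.forall_mem_cons] at hR
    exact (ih h hR.2).trans (hK.1.2.1 R hR.1)

namespace Program

variable {P P' P'' : Program D} {S : Stratum D} {I J : Instance D} {R : RelName}

theorem IsResult.rel_eq (h : P.IsResult I J) (hR : R ∉ P.idb) : J.rel R = I.rel R :=
  StrataResult.rel_eq h fun S hS ⟨r, hr, hrR⟩ => hR ⟨r, ⟨S, hS, hr⟩, hrR⟩

/-- The program `P` followed by a stratum whose heads occur neither in the bodies of `P` nor in
those of the stratum. -/
def snoc (P : Program D) (S : Stratum D) (hsafe : ∀ r ∈ S, r.Safe)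
    (hfresh : ∀ r, P.HasRule r ∨ r ∈ S → ∀ R, r.Uses R → R ∉ S.heads) : Program D where
  strata := P.strata ++ [S]
  safe S' hS' := by
    rcases List.mem_append.1 hS' with hS' | hS'
    · exact P.safe S' hS'
    · exact List.mem_singleton.1 hS' ▸ hsafe
  stratified := P.stratified.concat fun S' hS' r hr p hp => by
    refine hfresh r ?_ _ ⟨_, hp, p, rfl, rfl⟩
    rcases List.mem_append.1 hS' with hS' | hS'
    · exact Or.inl ⟨S', hS', hr⟩
    · exact Or.inr (List.mem_singleton.1 hS' ▸ hr)

section snoc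

variable {hsafe : ∀ r ∈ S, r.Safe}
  {hfresh : ∀ r, P.HasRule r ∨ r ∈ S → ∀ R, r.Uses R → R ∉ S.heads}

theorem hasRule_snoc {r : Rule D} :
    (P.snoc S hsafe hfresh).HasRule r ↔ P.HasRule r ∨ r ∈ S := by
  simp only [HasRule, snoc, List.mem_append, List.mem_singleton, or_and_right, exists_or,
    exists_eq_left]

theorem idb_snoc : (P.snoc S hsafe hfresh).idb = P.idb ∪ S.heads := by
  ext R
  simp only [idb, Stratum.heads, hasRule_snoc, or_and_right, exists_or, Set.mem_ofPred_eq,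
    Set.mem_union]

theorem isResult_snoc :
    (P.snoc S hsafe hfresh).IsResult I J ↔ ∃ K, P.IsResult I K ∧ S.IsResult K J :=
  strataResult_concat

end snoc

/-- Every result of `P'` contains the relations that `P` computes for its IDB names. -/
def ExtendedBy (P P' : Program D) : Prop :=
  P.idb ⊆ P'.idb ∧
    ∀ I J', P'.IsResult I J' → ∃ J, P.IsResult I J ∧ ∀ R ∈ P.idb, J'.rel R = J.rel R

theorem ExtendedBy.trans (h : P.ExtendedBy P') (h' : P'.ExtendedBy P'') : P.ExtendedBy P'' := by
  refine ⟨h.1.trans h'.1, fun I J'' hJ'' => ?_⟩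
  obtain ⟨J', hJ', heq'⟩ := h'.2 I J'' hJ''
  obtain ⟨J, hJ, heq⟩ := h.2 I J' hJ'
  exact ⟨J, hJ, fun R hR => (heq' R (h.1 hR)).trans (heq R hR)⟩

/-- A program over `Γ` in which the relation names in the body of a rule have smaller identifiers
than the one in the head. -/
structure RankedOver (P : Program D) (Γ : Schema) : Prop where
  isOver : P.Over Γ
  id_lt : ∀ r, P.HasRule r → ∀ R, r.Uses R → R.id < r.head.name.id

theorem RankedOver.nonrecursive (h : P.RankedOver Γ) : P.Nonrecursive := by
  have hlt {R₁ R₂ : RelName} (hR : Relation.TransGen P.DependsOn R₁ R₂) : R₂.id < R₁.id := by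
    refine Relation.TransGen.head_induction_on hR ?_ ?_
    · rintro _ ⟨-, -, r, hr, rfl, hu⟩
      exact h.id_lt r hr _ hu
    · rintro _ R ⟨-, -, r, hr, rfl, hu⟩ - ih
      exact ih.trans (h.id_lt r hr _ hu)
  exact fun R hR => lt_irrefl _ (hlt hR)

theorem RankedOver.mem_of_uses (h : P.RankedOver Γ) {r : Rule D} (hr : P.HasRule r)
    (hR : r.Uses R) : R ∈ Γ ∨ R ∈ P.idb := by
  by_cases hidb : R ∈ P.idb
  · exact Or.inr hidb
  · exact Or.inl (h.isOver.1 R ⟨⟨r, hr, hR⟩, hidb⟩)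

theorem RankedOver.snoc (h : P.RankedOver Γ) {k : ℕ} (hk : ∀ R, R ∈ Γ ∨ R ∈ P.idb → R.id < k)
    (hS : ∀ r ∈ S, r.head.name.id = k) (huses : ∀ r ∈ S, ∀ R, r.Uses R → R ∈ Γ ∨ R ∈ P.idb)
    {hsafe : ∀ r ∈ S, r.Safe}
    {hfresh : ∀ r, P.HasRule r ∨ r ∈ S → ∀ R, r.Uses R → R ∉ S.heads} :
    (P.snoc S hsafe hfresh).RankedOver Γ where
  isOver := by
    simp only [Over, edb, hasRule_snoc, idb_snoc]
    refine ⟨?_, ?_⟩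
    · rintro R ⟨⟨r, hr, hu⟩, hidb⟩
      have := hr.elim (h.mem_of_uses · hu) (huses r · R hu)
      exact this.resolve_right fun hR => hidb (Or.inl hR)
    · rintro R (hR | ⟨r, hr, rfl⟩) hΓ
      · exact h.isOver.2 R hR hΓ
      · exact (hk _ (Or.inl hΓ)).ne (hS r hr)
  id_lt r hr R hu := by
    rcases hasRule_snoc.1 hr with hr | hr
    · exact h.id_lt r hr R hu
    · exact hS r hr ▸ hk R (huses r hr R hu)

theorem exists_forall_id_lt (P : Program D) (Γ : Schema) :
    ∃ k, ∀ R : RelName, R ∈ Γ ∨ R ∈ P.idb → R.id < k := by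
  obtain ⟨N, hN⟩ := ((Γ.finite_toSet.union P.finite_idb).image RelName.id).bddAbove
  exact ⟨N + 1, fun R hR => Nat.lt_succ_of_le (hN ⟨R, hR, rfl⟩)⟩

end Program

/-! ### Defining relations by fresh strata -/

section Expressible

variable {m n p : ℕ} {P P' : Program D}

theorem Stratum.heads_map_toRule_subset (B : List (ColRule D m n)) (k : ℕ) :
    Stratum.heads (B.map (ColRule.toRule k)) ⊆ {⟨k, n⟩} := by
  rintro _ ⟨r, hr, rfl⟩
  obtain ⟨q, -, rfl⟩ := List.mem_map.1 hr
  rfl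

theorem Stratum.consequences_map_toRule [Nonempty D] (B : List (ColRule D m n)) (k : ℕ)
    (J : Instance D) :
    Stratum.consequences (B.map (ColRule.toRule k)) J ⟨k, n⟩ = ⋃ q ∈ B, q.eval J := by
  simp only [Stratum.consequences, List.mem_map, Set.iUnion_exists, Set.biUnion_and',
    Set.iUnion_iUnion_eq_right, ColRule.consequences_toRule]

theorem Stratum.IsResult.rel_eq_biUnion_eval [Nonempty D] {B : List (ColRule D m n)} {k : ℕ}
    {I J : Instance D} (h : Stratum.IsResult (B.map (ColRule.toRule k)) I J)
    (hB : Stratum.Semipositive (B.map (ColRule.toRule k))) (hI : I.rel ⟨k, n⟩ = ∅) :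
    J.rel ⟨k, n⟩ = ⋃ q ∈ B, q.eval J := by
  rw [h.rel_eq_union_consequences hB, hI, Set.empty_union, Stratum.consequences_map_toRule]

namespace Program

theorem extendedBy_snoc {S : Stratum D} {hsafe : ∀ r ∈ S, r.Safe}
    {hfresh : ∀ r, P.HasRule r ∨ r ∈ S → ∀ R, r.Uses R → R ∉ S.heads}
    (hdisj : Disjoint P.idb S.heads) : P.ExtendedBy (P.snoc S hsafe hfresh) := by
  refine ⟨idb_snoc ▸ Set.subset_union_left, fun I J' hJ' => ?_⟩
  obtain ⟨J, hJ, hS⟩ := isResult_snoc.1 hJ'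
  exact ⟨J, hJ, fun R hR => hS.1.2.1 R (hdisj.notMem_of_mem_left hR)⟩

/-- Over every instance of `Γ`, the program `P` computes the relation `X I` under the IDB name
`⟨k, n⟩`. -/
def Computes (P : Program D) (Γ : Schema) (k : ℕ) (X : Instance D → Set (Tuple D n)) : Prop :=
  ⟨k, n⟩ ∈ P.idb ∧ ∀ I J, I.Over Γ → P.IsResult I J → J.rel ⟨k, n⟩ = X I

theorem ExtendedBy.computes (h : P.ExtendedBy P') {k : ℕ} {X : Instance D → Set (Tuple D n)}
    (hX : P.Computes Γ k X) : P'.Computes Γ k X := by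
  refine ⟨h.1 hX.1, fun I J' hI hJ' => ?_⟩
  obtain ⟨J, hJ, heq⟩ := h.2 I J' hJ'
  exact (heq _ hX.1).trans (hX.2 I J hI hJ)

theorem RankedOver.exists_define [Nonempty D] (h : P.RankedOver Γ) {B : List (ColRule D m n)}
    (hB : B ≠ []) (hlim : ∀ q ∈ B, ∀ i, q.Limited i)
    (huses : ∀ q ∈ B, ∀ R, q.Uses R → R ∈ Γ ∨ R ∈ P.idb) :
    ∃ P' : Program D, P'.RankedOver Γ ∧ P.ExtendedBy P' ∧ ∃ k, ⟨k, n⟩ ∈ P'.idb ∧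
      ∀ I J, I.Over Γ → P'.IsResult I J → J.rel ⟨k, n⟩ = ⋃ q ∈ B, q.eval J := by
  obtain ⟨k, hk⟩ := P.exists_forall_id_lt Γ
  let S : Stratum D := B.map (ColRule.toRule k)
  have hheads {R : RelName} (hR : R ∈ Γ ∨ R ∈ P.idb) : R ∉ S.heads := fun hS =>
    (hk R hR).ne (congrArg RelName.id (Stratum.heads_map_toRule_subset B k hS))
  have hSsafe : ∀ r ∈ S, r.Safe :=
    List.forall_mem_map.2 fun q hq => ColRule.safe_toRule (hlim q hq) k
  have hSuses : ∀ r ∈ S, ∀ R, r.Uses R → R ∈ Γ ∨ R ∈ P.idb :=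
    List.forall_mem_map.2 fun q hq R hR => huses q hq R (ColRule.uses_of_uses_toRule hR)
  have hfresh (r) (hr : P.HasRule r ∨ r ∈ S) (R) (hR : r.Uses R) : R ∉ S.heads :=
    hheads (hr.elim (h.mem_of_uses · hR) (hSuses r · R hR))
  have hmem : ⟨k, n⟩ ∈ S.heads := by
    obtain ⟨q, hq⟩ := List.exists_mem_of_ne_nil B hB
    exact ⟨q.toRule k, List.mem_map_of_mem hq, rfl⟩
  have hsemi : S.Semipositive := fun r hr p hp => hfresh r (Or.inr hr) _ ⟨_, hp, p, rfl, rfl⟩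
  refine ⟨P.snoc S hSsafe hfresh, h.snoc hk (List.forall_mem_map.2 fun _ _ => rfl) hSuses,
    extendedBy_snoc (Set.disjoint_left.2 fun R hR => hheads (Or.inr hR)), k,
    idb_snoc ▸ Or.inr hmem, fun I J hI hJ => ?_⟩
  obtain ⟨K, hK, hS⟩ := isResult_snoc.1 hJ
  refine hS.rel_eq_biUnion_eval hsemi ?_
  rw [hK.rel_eq fun hidb => hheads (Or.inr hidb) hmem, hI _ fun hΓ => hheads (Or.inl hΓ) hmem]

end Program

/-- The rule `T($1, …, $n, s) ← R($1, …, $n), $i = y·s·z` with `R = ⟨k, n⟩`. The variables `y` and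
`z` are the last two columns. -/
def ColRule.substring (k : ℕ) (i : Fin n) : ColRule D (n + 1 + 2) (n + 1) where
  head j := .pvar (Fin.castAdd 2 j)
  body :=
    [.mem ⟨k, n⟩ fun j => .pvar (Fin.castAdd 2 j.castSucc),
      .eq (.pvar (Fin.castAdd 2 i.castSucc))
        (.concat (.concat (.pvar (Fin.natAdd (n + 1) 0)) (.pvar (Fin.castAdd 2 (Fin.last n))))
          (.pvar (Fin.natAdd (n + 1) 1)))]

theorem ColRule.limited_substring (k : ℕ) (i : Fin n) (v : Fin (n + 1 + 2)) :
    (substring k i : ColRule D _ _).Limited v := by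
  have hcol : ∀ j : Fin n, (substring k i : ColRule D _ _).Limited (Fin.castAdd 2 j.castSucc) :=
    limited_of_mem_pvar ⟨k, n⟩ (fun j => Fin.castAdd 2 j.castSucc) List.mem_cons_self
  have hsplit {w} := limited_of_eq (q := (substring k i : ColRule D _ _)) (i := w)
    (List.mem_cons_of_mem _ List.mem_cons_self) (by rintro _ ⟨⟩; exact hcol i)
  refine Fin.addCases (Fin.lastCases (hsplit ?_) hcol)
    (Fin.forall_fin_two.2 ⟨hsplit ?_, hsplit ?_⟩) v <;> simp [PathExpr.vars]

theorem ColRule.eval_substring (k : ℕ) (i : Fin n) (J : Instance D) :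
    (substring k i).eval J = {u | ∃ t ∈ J.rel ⟨k, n⟩, ∃ s : Path D, s <:+: t i ∧
      u = Fin.snoc (α := fun _ => Path D) t s} := by
  ext u
  simp only [eval, substring, List.forall_mem_cons, ColLiteral.Sat, ColExpr.apply, PathExpr.eval,
    List.not_mem_nil, false_imp_iff, implies_true, and_true, Set.mem_ofPred_eq]
  constructor
  · rintro ⟨t, ⟨ht, hsub⟩, rfl⟩
    refine ⟨_, ht, _, ⟨_, _, hsub.symm⟩, funext (Fin.lastCases ?_ fun j => ?_)⟩ <;> simp
  · rintro ⟨t, ht, s, ⟨y, z, hsub⟩, rfl⟩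
    refine ⟨Fin.append (Fin.snoc (α := fun _ => Path D) t s) ![y, z], ⟨?_, ?_⟩, ?_⟩
    · simpa using ht
    · simpa using hsub.symm
    · simp

/-- Every ranked program over `Γ` extends to one that computes `X` in addition to what it already
computes. -/
def Expressible (Γ : Schema) (X : Instance D → Set (Tuple D n)) : Prop :=
  ∀ P : Program D, P.RankedOver Γ →
    ∃ P' : Program D, P'.RankedOver Γ ∧ P.ExtendedBy P' ∧ ∃ k, P'.Computes Γ k X

namespace Expressible

variable [Nonempty D] {X : Instance D → Set (Tuple D n)} {Y : Instance D → Set (Tuple D m)}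
  {l : ℕ}

theorem of_rules₂ {Z : Instance D → Set (Tuple D p)} (hX : Expressible Γ X)
    (hY : Expressible Γ Y) (B : ℕ → ℕ → List (ColRule D l p)) (hB : ∀ k k', B k k' ≠ [])
    (hlim : ∀ k k', ∀ q ∈ B k k', ∀ i, q.Limited i)
    (huses : ∀ k k', ∀ q ∈ B k k', ∀ R, q.Uses R → R = ⟨k, n⟩ ∨ R = ⟨k', m⟩)
    (heval : ∀ k k' I J, J.rel ⟨k, n⟩ = X I → J.rel ⟨k', m⟩ = Y I →
      ⋃ q ∈ B k k', q.eval J = Z I) : Expressible Γ Z := by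
  intro P hP
  obtain ⟨P₁, hP₁, hPP₁, k, hk⟩ := hX P hP
  obtain ⟨P₂, hP₂, hP₁P₂, k', hk'⟩ := hY P₁ hP₁
  replace hk := hP₁P₂.computes hk
  obtain ⟨P₃, hP₃, hP₂P₃, k'', hk'', hJ⟩ := hP₂.exists_define (hB k k') (hlim k k')
    fun q hq R hR => Or.inr <| by rcases huses k k' q hq R hR with rfl | rfl; exacts [hk.1, hk'.1]
  refine ⟨P₃, hP₃, hPP₁.trans (hP₁P₂.trans hP₂P₃), k'', hk'', fun I J hI hIJ => ?_⟩
  rw [hJ I J hI hIJ]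
  exact heval k k' I J ((hP₂P₃.computes hk).2 I J hI hIJ) ((hP₂P₃.computes hk').2 I J hI hIJ)

theorem of_rule {Y : Instance D → Set (Tuple D p)} (hX : Expressible Γ X)
    (q : ℕ → ColRule D l p) (hlim : ∀ k i, (q k).Limited i)
    (huses : ∀ k R, (q k).Uses R → R = ⟨k, n⟩)
    (heval : ∀ k I J, J.rel ⟨k, n⟩ = X I → (q k).eval J = Y I) : Expressible Γ Y := by
  refine hX.of_rules₂ hX (fun k _ => [q k]) (fun _ _ => List.cons_ne_nil _ _) ?_ ?_ ?_
  · exact fun k _ => List.forall_mem_singleton.2 (hlim k)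
  · exact fun k _ => List.forall_mem_singleton.2 fun R hR => Or.inl (huses k R hR)
  · intro k _ I J hJ _
    simpa using heval k I J hJ

theorem rel {R : RelName} (hR : R ∈ Γ) : Expressible Γ fun I : Instance D => I.rel R := by
  intro P hP
  let q : ColRule D R.arity R.arity := ⟨.pvar, [.mem R .pvar]⟩
  obtain ⟨P', hP', hPP', k, hk, hJ⟩ := hP.exists_define (B := [q]) (List.cons_ne_nil _ _)
    (List.forall_mem_singleton.2 (ColRule.limited_of_mem_pvar R id List.mem_cons_self))
    (List.forall_mem_singleton.2 fun R' hR' => by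
      simp only [ColRule.Uses, q, List.mem_singleton, exists_eq_left, ColLiteral.Uses] at hR'
      exact Or.inl (hR' ▸ hR))
  refine ⟨P', hP', hPP', k, hk, fun I J hI hIJ => ?_⟩
  have hJR : J.rel R = I.rel R := hIJ.rel_eq fun hidb => hP'.isOver.2 R hidb hR
  simp only [hJ I J hI hIJ, ← hJR]
  ext t
  simp [ColRule.eval, q, ColLiteral.Sat, ColExpr.apply, PathExpr.eval]

theorem const (C : Finset (Tuple D n)) :
    Expressible Γ fun _ : Instance D => {t : Tuple D n | t ∈ C} := by
  intro P hP
  -- The rule `never` makes the head an IDB name also when `C` is empty.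
  let never : ColRule D 0 n := ⟨fun _ => .empty, [.eq .empty (.pack .empty)]⟩
  let fact (t : Tuple D n) : ColRule D 0 n := ⟨fun j => .ofPath (t j), []⟩
  obtain ⟨P', hP', hPP', k, hk, hJ⟩ := hP.exists_define (B := never :: C.toList.map fact)
    (List.cons_ne_nil _ _) (fun _ _ i => i.elim0) (by
      simp [ColRule.Uses, never, fact, ColLiteral.Uses])
  refine ⟨P', hP', hPP', k, hk, fun I J hI hIJ => ?_⟩
  rw [hJ I J hI hIJ]
  ext t
  simp [ColRule.eval, never, fact, ColLiteral.Sat, ColExpr.apply, PathExpr.eval,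
    PathExpr.eval_ofPath]

theorem union {Y : Instance D → Set (Tuple D n)} (hX : Expressible Γ X) (hY : Expressible Γ Y) :
    Expressible Γ fun I => X I ∪ Y I := by
  refine hX.of_rules₂ hY (fun k k' => [⟨.pvar, [.mem ⟨k, n⟩ .pvar]⟩, ⟨.pvar, [.mem ⟨k', n⟩ .pvar]⟩])
    (fun _ _ => List.cons_ne_nil _ _) ?_ ?_ ?_
  · simp only [List.forall_mem_cons, List.not_mem_nil, false_imp_iff, implies_true, and_true]
    exact fun k k' => ⟨ColRule.limited_of_mem_pvar ⟨k, n⟩ id List.mem_cons_self,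
      ColRule.limited_of_mem_pvar ⟨k', n⟩ id List.mem_cons_self⟩
  · simp [ColRule.Uses, ColLiteral.Uses]
  · intro k k' I J hJ hJ'
    ext t
    simp [ColRule.eval, ColLiteral.Sat, ColExpr.apply, PathExpr.eval, hJ, hJ']

theorem diff {Y : Instance D → Set (Tuple D n)} (hX : Expressible Γ X) (hY : Expressible Γ Y) :
    Expressible Γ fun I => X I \ Y I := by
  refine hX.of_rules₂ hY (fun k k' => [⟨.pvar, [.mem ⟨k, n⟩ .pvar, .notMem ⟨k', n⟩ .pvar]⟩])
    (fun _ _ => List.cons_ne_nil _ _) ?_ ?_ ?_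
  · exact fun k k' => List.forall_mem_singleton.2
      (ColRule.limited_of_mem_pvar ⟨k, n⟩ id List.mem_cons_self)
  · simpa [ColRule.Uses, ColLiteral.Uses] using fun k k' R => ⟨Or.inl, Or.inr⟩
  · intro k k' I J hJ hJ'
    ext t
    simp [ColRule.eval, ColLiteral.Sat, ColExpr.apply, PathExpr.eval, hJ, hJ']

theorem prod (hX : Expressible Γ X) (hY : Expressible Γ Y) :
    Expressible Γ fun I => {u : Tuple D (n + m) | ∃ s ∈ X I, ∃ t ∈ Y I, u = Fin.append s t} := by
  refine hX.of_rules₂ hY (fun k k' => [⟨.pvar,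
      [.mem ⟨k, n⟩ fun i => .pvar (Fin.castAdd m i),
        .mem ⟨k', m⟩ fun j => .pvar (Fin.natAdd n j)]⟩])
    (fun _ _ => List.cons_ne_nil _ _) ?_ ?_ ?_
  · refine fun k k' => List.forall_mem_singleton.2 (Fin.addCases (fun i => ?_) fun j => ?_)
    · exact ColRule.limited_of_mem_pvar ⟨k, n⟩ (Fin.castAdd m) List.mem_cons_self i
    · exact ColRule.limited_of_mem_pvar ⟨k', m⟩ (Fin.natAdd n)
        (List.mem_cons_of_mem _ List.mem_cons_self) j
  · simpa [ColRule.Uses, ColLiteral.Uses] using fun k k' R => ⟨Or.inl, Or.inr⟩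
  · intro k k' I J hJ hJ'
    ext u
    simp only [List.mem_singleton, Set.iUnion_iUnion_eq_left]
    simp only [ColRule.eval, List.forall_mem_cons, ColLiteral.Sat, ColExpr.apply, PathExpr.eval,
      hJ, hJ', List.not_mem_nil, false_imp_iff, implies_true, and_true, Set.mem_ofPred_eq]
    constructor
    · rintro ⟨t, ⟨hX, hY⟩, rfl⟩
      exact ⟨_, hX, _, hY, Fin.append_castAdd_natAdd.symm⟩
    · rintro ⟨s, hs, t, ht, rfl⟩
      exact ⟨Fin.append s t, by simp [hs, ht], rfl⟩

theorem select (hX : Expressible Γ X) (α β : ColExpr D n) :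
    Expressible Γ fun I => {t | t ∈ X I ∧ α.apply t = β.apply t} := by
  refine hX.of_rule (fun k => ⟨.pvar, [.mem ⟨k, n⟩ .pvar, .eq α β]⟩) ?_ ?_ ?_
  · exact fun k => ColRule.limited_of_mem_pvar ⟨k, n⟩ id List.mem_cons_self
  · simp [ColRule.Uses, ColLiteral.Uses]
  · intro k I J hJ
    ext t
    simp [ColRule.eval, ColLiteral.Sat, ColExpr.apply, PathExpr.eval, hJ]

theorem project (hX : Expressible Γ X) (α : Fin p → ColExpr D n) :
    Expressible Γ fun I => {u : Tuple D p | ∃ t ∈ X I, u = fun j => (α j).apply t} := by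
  refine hX.of_rule (fun k => ⟨α, [.mem ⟨k, n⟩ .pvar]⟩) ?_ ?_ ?_
  · exact fun k => ColRule.limited_of_mem_pvar ⟨k, n⟩ id List.mem_cons_self
  · simp [ColRule.Uses, ColLiteral.Uses]
  · intro k I J hJ
    simp [ColRule.eval, ColLiteral.Sat, ColExpr.apply, PathExpr.eval, hJ]

theorem unpack (hX : Expressible Γ X) (i : Fin n) :
    Expressible Γ fun I => {u | ∃ t ∈ X I, ∃ s : Path D, t i = [Value.pack s] ∧
      u = Function.update t i s} := by
  let α : Fin n → ColExpr D n := Function.update .pvar i (.pack (.pvar i))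
  have hα (t : Tuple D n) :
      (fun j => (α j).apply t) = Function.update t i [Value.pack (t i)] := by
    ext1 j
    rcases eq_or_ne j i with rfl | hj
    · simp [α, ColExpr.apply, PathExpr.eval]
    · simp [α, hj, ColExpr.apply, PathExpr.eval]
  refine hX.of_rule (fun k => ⟨.pvar, [.mem ⟨k, n⟩ α]⟩) (fun k j => ?_) ?_ ?_
  · refine ColRule.limited_of_mem List.mem_cons_self (j := j) ?_
    rcases eq_or_ne j i with rfl | hj
    · simp [α, PathExpr.vars]
    · simp [α, hj, PathExpr.vars]
  · simp [ColRule.Uses, ColLiteral.Uses]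
  · intro k I J hJ
    ext u
    simp only [ColRule.eval, List.forall_mem_singleton, ColLiteral.Sat, hα, hJ, Set.mem_ofPred_eq]
    constructor
    · rintro ⟨u, hu, rfl⟩
      exact ⟨_, hu, u i, by simp, by simp [ColExpr.apply, PathExpr.eval]⟩
    · rintro ⟨t, ht, s, hs, rfl⟩
      exact ⟨Function.update t i s, by simpa [← hs] using ht, rfl⟩

theorem sub (hX : Expressible Γ X) (i : Fin n) :
    Expressible Γ fun I => {u : Tuple D (n + 1) | ∃ t ∈ X I, ∃ s : Path D, s <:+: t i ∧
      u = Fin.snoc (α := fun _ => Path D) t s} := by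
  refine hX.of_rule (fun k => .substring k i) (fun k => ColRule.limited_substring k i) ?_ ?_
  · simp [ColRule.Uses, ColLiteral.Uses, ColRule.substring]
  · exact fun k I J hJ => hJ ▸ ColRule.eval_substring k i J

end Expressible

theorem AlgExpr.expressible [Nonempty D] (E : AlgExpr D Γ n) :
    Expressible Γ fun I => E.eval I := by
  induction E with
  | rel R hR => exact .rel hR
  | const C => exact .const C
  | union E F hE hF => exact hE.union hF
  | diff E F hE hF => exact hE.diff hF
  | prod E F hE hF => exact hE.prod hF
  | select α β E hE => exact hE.select α β
  | project α E hE => exact hE.project α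
  | unpack i E hE => exact hE.unpack i
  | sub i E hE => exact hE.sub i

theorem AlgExpr.exists_program [Nonempty D] (E : AlgExpr D Γ n) :
    ∃ P : Program D, P.Over Γ ∧ P.Nonrecursive ∧ ∃ k, ⟨k, n⟩ ∈ P.idb ∧
      ∀ I : Instance D, I.Over Γ → ∃ J, P.IsResult I J ∧ J.rel ⟨k, n⟩ = E.eval I := by
  let P₀ : Program D := ⟨[], by simp, trivial⟩
  have hP₀ : P₀.RankedOver Γ := by
    constructor <;> simp [P₀, Program.Over, Program.edb, Program.idb, Program.HasRule]
  obtain ⟨P, hP, -, k, hk, hE⟩ := E.expressible P₀ hP₀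
  obtain ⟨g, hg⟩ := hP.nonrecursive.exists_symbolicInstance Γ
  exact ⟨P, hP.isOver, hP.nonrecursive, k, hk, fun I hI => ⟨_, hg I hI, hE I _ hI (hg I hI)⟩⟩

end Expressible

end SeqDatalog

theorem mainTheorem10_general {D : Type*} [Nonempty D] (Γ : SeqDatalog.Schema) :
    (∀ P : SeqDatalog.Program D, P.Nonrecursive →
      ∀ T, ∃ E : SeqDatalog.AlgExpr D Γ T.arity,
        ∀ I : SeqDatalog.Instance D, I.Over Γ →
          ∃ J : SeqDatalog.Instance D, P.IsResult I J ∧ J.rel T = E.eval I) ∧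
    (∀ (n : ℕ) (E : SeqDatalog.AlgExpr D Γ n),
      ∃ P : SeqDatalog.Program D, P.Over Γ ∧ P.Nonrecursive ∧
        ∃ k : ℕ, (⟨k, n⟩ : SeqDatalog.RelName) ∈ P.idb ∧
          ∀ I : SeqDatalog.Instance D, I.Over Γ →
            ∃ J : SeqDatalog.Instance D, P.IsResult I J ∧
              J.rel ⟨k, n⟩ = E.eval I) :=
  ⟨fun _ hP T => hP.exists_algExpr Γ T, fun _ E => E.exists_program⟩

theorem mainTheorem10 {D : Type*} [Countable D] [Infinite D] (Γ : SeqDatalog.Schema) :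
    (∀ P : SeqDatalog.Program D, P.Over Γ → P.Nonrecursive →
      ∀ T ∈ P.idb, ∃ E : SeqDatalog.AlgExpr D Γ T.arity,
        ∀ I : SeqDatalog.Instance D, I.Over Γ →
          ∃ J : SeqDatalog.Instance D, P.IsResult I J ∧ J.rel T = E.eval I) ∧
    (∀ (n : ℕ) (E : SeqDatalog.AlgExpr D Γ n),
      ∃ P : SeqDatalog.Program D, P.Over Γ ∧ P.Nonrecursive ∧
        ∃ k : ℕ, (⟨k, n⟩ : SeqDatalog.RelName) ∈ P.idb ∧
          ∀ I : SeqDatalog.Instance D, I.Over Γ →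
            ∃ J : SeqDatalog.Instance D, P.IsResult I J ∧
              J.rel ⟨k, n⟩ = E.eval I) := by
  exact ⟨fun P _ hP T _ => (mainTheorem10_general Γ).1 P hP T, (mainTheorem10_general Γ).2⟩
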